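/- Let $\mathcal N$ be a finite set of agents, where agent $i$ arrives with probability $p_i\in[0,1]$, independently of the others; let $S\subseteq\mathcal N$ be the random set of arriving agents and $\tilde n=\mathbb E[|S|]=\sum_{i\in\mathcal N}p_i$. A \emph{4-step cost function} is a non-decreasing $c:\mathbb N\to[0,\infty]$ with $c(0)=0$ and $c(\ell)>0$ for $\ell\ge 1$, such that the positive integers split into consecutive segments of length at least $4$ on each of which $c$ is constant. Given a non-empty finite set $M$ of machines with 4-step cost functions $(c_j)_{j\in M}$ and a set $S$ of agents, every $i\in S$ chooses a machine $s_i\in M$. Write $S_j(s)=\{i\in S: s_i=j\}$ and $C(s)=\sum_{j\in M}c_j(|S_j(s)|)$. A \emph{resource-aware protocol} $\Xi$ (which may depend on $\mathcal N$ and $p$) assigns to each agent $i\in S_j(s)$ a cost share $\xi_i(s)\in[0,\infty]$ that depends only on $i$, $j$, $M$, the cost functions and the set $S_j(s)$, such that $\sum_{i\in S_j(s)}\xi_i(s)\ge c_j(|S_j(s)|)$, and $\xi_i(s)<\infty$ whenever $c_j(|S_j(s)|)<\infty$. A profile $s$ is a pure Nash equilibrium if no agent can decrease her share by unilaterally changing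 her machine. The protocol is \emph{stable} if for all $M$, $(c_j)$ and $S\subseteq\mathcal N$ the resulting game has a pure Nash equilibrium. Let $$\mathrm{PoA}(S,M,c,\Xi)=\frac{\max_{s\text{ pure Nash equilibrium}}\ \sum_{i\in S}\xi_i(s)}{\min_{s}C(s)}$$ (read as $0$ if $S=\emptyset$ or if no schedule has finite cost) and $\mathrm{ExpectedPoA}(\Xi)=\sup_{M,c}\mathbb E_S[\mathrm{PoA}(S,M,c,\Xi)]$, the supremum being over all non-empty finite sets of machines with 4-step cost functions. \textbf{Theorem.} There is an absolute constant $K>0$ such that for every finite $\mathcal N$ and all $p\in[0,1]^{\mathcal N}$ there is a stable resource-aware protocol $\Xi$ with $$\mathrm{ExpectedPoA}(\Xi)\le K\cdot\max\{1,\log\tilde n\}.$$ In particular $\mathrm{ExpectedPoA}(\Xi)=O(\log\tilde n)$. -/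

import Mathlib

open scoped ENNReal

noncomputable section

/-- Cost functions `c : ℕ → [0, ∞]` of a machine (`c ℓ` is the cost of processing `ℓ` jobs) that are
4-step functions: `c 0 = 0`, `c` is non-decreasing, every non-zero load has a non-zero cost, and the
positive loads split into consecutive segments of lengths `len 0, len 1, … ≥ 4` on each of which `c`
is constant.  The value `∞` is allowed, so that machines with a capacity are included. -/
structure IsFourStepCost (c : ℕ → ℝ≥0∞) : Prop where
  zero : c 0 = 0
  mono : Monotone c
  pos : ∀ x, 0 < x → 0 < c x
  step : ∃ len : ℕ → ℕ, (∀ k, 4 ≤ len k) ∧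
    ∀ k x, ∑ i ∈ Finset.range k, len i < x → x ≤ ∑ i ∈ Finset.range (k + 1), len i →
      c x = c (∑ i ∈ Finset.range (k + 1), len i)

/-- The cost shares in a game with `m` machines: `ξ j T i` is the share of agent `i ∈ T` on
machine `j` when `T` is the set of agents that use machine `j`.  (Values at `i ∉ T` play no role.) -/
abbrev ShareRule (N : Type*) (m : ℕ) := Fin m → Finset N → N → ℝ≥0∞

/-- A resource-aware protocol: the shares on a machine depend on the set of machines and their cost
functions `c`, and on the set of agents that use this machine, but not on the other agents. -/
abbrev Protocol (N : Type*) := ∀ m : ℕ, (Fin m → ℕ → ℝ≥0∞) → ShareRule N m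

section Game

variable {N : Type*} {m : ℕ} {S : Finset N}

/-- The set of agents on machine `j` in the strategy profile `s` of the arriving agents `S`. -/
def users (s : S → Fin m) (j : Fin m) : Finset N :=
  (Finset.univ.filter fun i : S => s i = j).map (Function.Embedding.subtype _)

/-- The share paid by agent `i` in the profile `s`. -/
def agentShare (ξ : ShareRule N m) (s : S → Fin m) (i : S) : ℝ≥0∞ :=
  ξ (s i) (users s (s i)) i

/-- The total cost generated by the profile `s`. -/
def generatedCost (c : Fin m → ℕ → ℝ≥0∞) (s : S → Fin m) : ℝ≥0∞ :=
  ∑ j, c j (users s j).card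

/-- The total cost suffered by the agents in the profile `s`. -/
def sufferedCost (ξ : ShareRule N m) (s : S → Fin m) : ℝ≥0∞ :=
  ∑ j, ∑ i ∈ users s j, ξ j (users s j) i

variable [DecidableEq N]

/-- Pure Nash equilibria. -/
def IsPNE (ξ : ShareRule N m) (s : S → Fin m) : Prop :=
  ∀ (i : S) (j : Fin m), agentShare ξ s i ≤ agentShare ξ (Function.update s i j) i

/-- The price of anarchy of the game played by the agents `S`: the largest total cost suffered in a
pure Nash equilibrium, divided by the smallest total cost of a schedule.  The undefined quotients
`0 / 0` (no agents) and `∞ / ∞` (no schedule of finite cost) are `0`. -/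
def poa (c : Fin m → ℕ → ℝ≥0∞) (ξ : ShareRule N m) (S : Finset N) : ℝ≥0∞ :=
  (⨆ (s : S → Fin m) (_ : IsPNE ξ s), sufferedCost ξ s) / ⨅ s : S → Fin m, generatedCost c s

end Game

section Protocols

variable {N : Type*}

/-- The cost of each machine is covered by the agents that use it (overcharging is allowed), and
no agent is charged an infinite share on a machine whose cost is finite. -/
def Protocol.IsCostSharing (Ξ : Protocol N) : Prop :=
  ∀ (m : ℕ) (c : Fin m → ℕ → ℝ≥0∞), (∀ j, IsFourStepCost (c j)) →
    ∀ (j : Fin m) (T : Finset N),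
      c j T.card ≤ ∑ i ∈ T, Ξ m c j T i ∧
      (c j T.card ≠ ∞ → ∀ i ∈ T, Ξ m c j T i ≠ ∞)

variable [DecidableEq N]

/-- Every game induced by the protocol has a pure Nash equilibrium. -/
def Protocol.IsStable (Ξ : Protocol N) : Prop :=
  ∀ (m : ℕ) (c : Fin m → ℕ → ℝ≥0∞), 0 < m → (∀ j, IsFourStepCost (c j)) →
    ∀ S : Finset N, ∃ s : S → Fin m, IsPNE (Ξ m c) s

variable [Fintype N]

/-- The probability that exactly the agents in `S` arrive, when agent `i` arrives with
probability `p i`, independently of the other agents. -/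
def arrivalProb (p : N → ℝ) (S : Finset N) : ℝ :=
  (∏ i ∈ S, p i) * ∏ i ∈ Sᶜ, (1 - p i)

/-- The expected number of arriving agents. -/
def expectedArrivals (p : N → ℝ) : ℝ :=
  ∑ S : Finset N, arrivalProb p S * (S.card : ℝ)

/-- The expected price of anarchy: the supremum, over all non-empty finite sets of machines with
4-step cost functions, of the expectation of the price of anarchy over the random set of agents. -/
def Protocol.expectedPoA (p : N → ℝ) (Ξ : Protocol N) : ℝ≥0∞ :=
  ⨆ (m : ℕ) (c : Fin m → ℕ → ℝ≥0∞) (_ : 0 < m) (_ : ∀ j, IsFourStepCost (c j)),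
    ∑ S : Finset N, ENNReal.ofReal (arrivalProb p S) * poa c (Ξ m c) S

end Protocols

end

/-! Machines are filled in phases with doubling budgets `base`. For every set `S` of agents that can
be served at finite cost there is a phase `Φ` whose loads suffice for all of `S` and whose budget is
at most four times the optimum. The growth of one machine in one phase is a block; blocks are
ordered, and their tolls, between one and two times the budget, increase along this order. Greedy
filling is balanced with respect to tolls, and in any equilibrium every share stays below `2 * base
Φ`, because cheap slots suffice for everybody (`share_lt_of_isPNE`). This alone bounds the price of
anarchy by a multiple of `|S|` (`poa_share_le`).

To do better, a full machine without leaders must not pay a toll when many machines grow in its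
phase: if more than `b` do (a big phase), only its true cost is charged. This creates a danger, as
full blocks of late phases can be cheap and trap the agents. Some agents are therefore made leaders
and divided into `L` groups. A sole leader on a machine gets a price below all tolls that decreases
with a level counting big phases, so a full leaderless machine of a late big phase attracts her.
Three leaders of one group may ride free on a full machine, but a leader who is the only arriving
agent of her group cannot use this. If such a lone leader arrives, late full leaderless machines do
not occur in equilibrium (`phase_le_of_full`), and the price of anarchy is `O(b + number of
leaders)` (`sufferedCost_le_of_lone`).

Free triples serve stability (`exists_isPNE`). When leaders are fewer than used machines, all but at
most `3 * L ≤ b` of them are parked in triples, and the remaining ones sit alone on the machines of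
highest level. Since a big phase involves more than `b` machines, it offers enough places of its
level for all of them. Segments of length at least 4 leave room for a triple in a block and let the
first, second and later slots of a block carry different levels.

Groups have expected size between 1/4 and 1, so each has exactly one arrival with probability at
least 1/8, independently. With about `8 * log ñ` groups the event without a lone leader contributes
only a constant beyond the leaders' own share, and the expected number of leaders is at most `L`.
Both cases together give `O(log ñ)`. -/

/-- A sequence of load vectors `cap 0 ≤ cap 1 ≤ …` along which the machines are filled up.  Growing machine
`j` from `cap φ j` to `cap (φ + 1) j` is the block `(φ, j)`; the phases up to `last` have finite cost. -/
structure Plan (m : ℕ) (c : Fin m → ℕ → ℝ≥0∞) (n₀ : ℕ) where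
  cap : ℕ → Fin m → ℕ
  last : ℕ
  base : ℕ → ℝ
  cap_zero : ∀ j, cap 0 j = 0
  cap_succ : ∀ φ j, cap (φ + 1) j = cap φ j ∨ cap φ j + 4 ≤ cap (φ + 1) j
  cap_unbounded : ∀ j ℓ, ∃ φ, ℓ ≤ cap (φ + 1) j
  base_pos : 0 < base 0
  base_double : ∀ φ, 2 * base φ ≤ base (φ + 1)
  cost_le : ∀ φ ≤ last, ∑ j, c j (cap (φ + 1) j) ≤ ENNReal.ofReal (base φ)
  finite_le : ∀ j, ∀ ℓ ≤ n₀, c j ℓ ≠ ∞ → ℓ ≤ cap (last + 1) j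
  opt : ∀ x : Fin m → ℕ, 0 < ∑ j, x j → ∑ j, x j ≤ n₀ → ∑ j, c j (x j) ≠ ∞ →
    ∃ φ < last, ∑ j, x j ≤ ∑ j, cap (φ + 1) j ∧ ENNReal.ofReal (base φ) ≤ 4 * ∑ j, c j (x j)

/-! ### Blocks, tolls and levels of a plan -/

namespace Plan

variable {m n₀ : ℕ} {c : Fin m → ℕ → ℝ≥0∞} (pl : Plan m c n₀)

lemma cap_le_succ (φ : ℕ) (j : Fin m) : pl.cap φ j ≤ pl.cap (φ + 1) j := by
  rcases pl.cap_succ φ j with h | h <;> omega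

lemma cap_mono (j : Fin m) : Monotone fun φ => pl.cap φ j :=
  monotone_nat_of_le_succ fun φ => pl.cap_le_succ φ j

/-- The phase in which the `ℓ`-th slot of machine `j` is used. -/
noncomputable def phase (j : Fin m) (ℓ : ℕ) : ℕ := Nat.find (pl.cap_unbounded j ℓ)

lemma phase_le_iff {j : Fin m} {ℓ φ : ℕ} : pl.phase j ℓ ≤ φ ↔ ℓ ≤ pl.cap (φ + 1) j := by
  rw [phase, Nat.find_le_iff]
  exact ⟨fun ⟨k, hk, h⟩ => h.trans (pl.cap_mono j (Nat.succ_le_succ hk)), fun h => ⟨φ, le_rfl, h⟩⟩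

lemma le_cap_phase (j : Fin m) (ℓ : ℕ) : ℓ ≤ pl.cap (pl.phase j ℓ + 1) j :=
  pl.phase_le_iff.1 le_rfl

lemma cap_phase_lt {j : Fin m} {ℓ : ℕ} (h : 0 < ℓ) : pl.cap (pl.phase j ℓ) j < ℓ := by
  by_contra! hc
  rcases hp : pl.phase j ℓ with _ | φ
  · rw [hp, pl.cap_zero] at hc; omega
  · rw [hp] at hc
    have := pl.phase_le_iff.2 hc
    omega

lemma phase_mono (j : Fin m) : Monotone (pl.phase j) := fun _ b h =>
  pl.phase_le_iff.2 (h.trans (pl.le_cap_phase j b))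

/-- With load `ℓ` the current block of machine `j` is used up. -/
def Full (j : Fin m) (ℓ : ℕ) : Prop := pl.phase j ℓ ≠ pl.phase j (ℓ + 1)

variable {pl} in
lemma Full.eq_cap {j : Fin m} {ℓ : ℕ} (h : pl.Full j ℓ) : ℓ = pl.cap (pl.phase j ℓ + 1) j := by
  refine le_antisymm (pl.le_cap_phase j ℓ) ?_
  by_contra! hc
  exact h (le_antisymm (pl.phase_mono j (Nat.le_succ ℓ)) (pl.phase_le_iff.2 hc))

variable {pl} in
-- A non-empty block has length at least 4, so the four loads that end at a positive full one share
-- a phase. All separation between full loads comes from this.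
lemma Full.four_le {j : Fin m} {ℓ : ℕ} (h : pl.Full j ℓ) (h0 : 0 < ℓ) :
    4 ≤ ℓ ∧ ∀ k, ℓ ≤ k + 3 → k ≤ ℓ → pl.phase j k = pl.phase j ℓ := by
  have h1 := h.eq_cap
  have h2 := pl.cap_phase_lt (j := j) h0
  have h4 : pl.cap (pl.phase j ℓ) j + 4 ≤ ℓ := by
    rcases pl.cap_succ (pl.phase j ℓ) j with h3 | h3 <;> omega
  refine ⟨by omega, fun k hk hkl => le_antisymm (pl.phase_mono j hkl) ?_⟩
  by_contra! hc
  have := pl.phase_le_iff.1 (show pl.phase j k ≤ pl.phase j ℓ - 1 by omega)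
  rw [show pl.phase j ℓ - 1 + 1 = pl.phase j ℓ by omega] at this
  omega

/-- The position of the block of the `ℓ`-th slot of machine `j` in the order of all blocks. -/
noncomputable def idx (j : Fin m) (ℓ : ℕ) : ℕ := pl.phase j ℓ * m + j

lemma idx_mono (j : Fin m) : Monotone (pl.idx j) := fun _ _ h =>
  Nat.add_le_add_right (Nat.mul_le_mul_right m (pl.phase_mono j h)) _

lemma idx_injective {i j : Fin m} {a b : ℕ} (h : pl.idx i a = pl.idx j b) : i = j := by
  have h1 : pl.idx i a % m = i := by
    rw [idx, add_comm, Nat.add_mul_mod_self_right, Nat.mod_eq_of_lt i.isLt]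
  have h2 : pl.idx j b % m = j := by
    rw [idx, add_comm, Nat.add_mul_mod_self_right, Nat.mod_eq_of_lt j.isLt]
  exact Fin.ext (by rw [← h1, ← h2, h])

lemma lex_of_idx_le {i j : Fin m} {a b : ℕ} (h : pl.idx i a ≤ pl.idx j b) :
    pl.phase i a < pl.phase j b ∨ pl.phase i a = pl.phase j b ∧ i ≤ j := by
  unfold idx at h
  rcases lt_trichotomy (pl.phase i a) (pl.phase j b) with h1 | h1 | h1
  · exact Or.inl h1
  · rw [h1] at h
    exact Or.inr ⟨h1, Fin.le_def.2 (by omega)⟩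
  · have := Nat.mul_le_mul_right m (Nat.succ_le_of_lt h1)
    have := j.isLt
    rw [Nat.succ_mul] at *
    omega

lemma phase_le_of_idx_le {i j : Fin m} {a b : ℕ} (h : pl.idx i a ≤ pl.idx j b) :
    pl.phase i a ≤ pl.phase j b := by
  rcases pl.lex_of_idx_le h with h | h <;> omega

lemma full_of_idx_lt {j : Fin m} {ℓ : ℕ} (h : pl.idx j ℓ < pl.idx j (ℓ + 1)) : pl.Full j ℓ := by
  intro he
  rw [idx, idx, he] at h
  exact lt_irrefl _ h

lemma idx_succ_of_not_full {j : Fin m} {ℓ : ℕ} (h : ¬ pl.Full j ℓ) :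
    pl.idx j (ℓ + 1) = pl.idx j ℓ := by
  rw [Full, not_not] at h
  rw [idx, idx, h]

lemma base_mono : Monotone pl.base := by
  have hpos : ∀ φ, 0 < pl.base φ := by
    intro φ
    induction φ with
    | zero => exact pl.base_pos
    | succ φ ih => linarith [pl.base_double φ]
  exact monotone_nat_of_le_succ fun φ => by linarith [pl.base_double φ, hpos φ]

lemma base_pos' (φ : ℕ) : 0 < pl.base φ := pl.base_pos.trans_le (pl.base_mono (Nat.zero_le φ))

/-- The price of a block that is not used up. -/
noncomputable def toll (φ : ℕ) (j : Fin m) : ℝ≥0∞ :=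
  -- The factor lies in `[1, 2)`: doubling of `base` orders tolls by phase, and the machine index
  -- breaks ties inside a phase.
  if φ ≤ pl.last then ENNReal.ofReal (pl.base φ * (1 + (j : ℕ) / m)) else ∞

lemma div_lt_one' (j : Fin m) : ((j : ℕ) / m : ℝ) < 1 := by
  have : 0 < m := j.pos
  rw [div_lt_one (by positivity)]
  exact_mod_cast j.isLt

lemma base_le_toll (φ : ℕ) (j : Fin m) : ENNReal.ofReal (pl.base φ) ≤ pl.toll φ j := by
  unfold toll
  split_ifs
  · apply ENNReal.ofReal_le_ofReal
    have := pl.base_pos' φ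
    have : 0 ≤ ((j : ℕ) / m : ℝ) := by positivity
    nlinarith
  · exact le_top

lemma toll_lt {φ : ℕ} (hφ : φ ≤ pl.last) (j : Fin m) :
    pl.toll φ j < ENNReal.ofReal (2 * pl.base φ) := by
  rw [toll, if_pos hφ]
  have h1 := pl.base_pos' φ
  apply (ENNReal.ofReal_lt_ofReal_iff (by positivity)).2
  have := div_lt_one' j
  nlinarith

lemma toll_ne_top {φ : ℕ} (hφ : φ ≤ pl.last) (j : Fin m) : pl.toll φ j ≠ ∞ := by
  rw [toll, if_pos hφ]
  exact ENNReal.ofReal_ne_top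

lemma toll_lt_of_phase_lt {φ ψ : ℕ} (h : φ < ψ) (hφ : φ ≤ pl.last) (i j : Fin m) :
    pl.toll φ i < pl.toll ψ j := by
  refine (pl.toll_lt hφ i).trans_le (le_trans ?_ (pl.base_le_toll ψ j))
  exact ENNReal.ofReal_le_ofReal ((pl.base_double φ).trans (pl.base_mono h))

lemma toll_le_of_idx_le {i j : Fin m} {a b : ℕ} (h : pl.idx i a ≤ pl.idx j b) :
    pl.toll (pl.phase i a) i ≤ pl.toll (pl.phase j b) j := by
  by_cases hl : pl.phase j b ≤ pl.last
  · rcases pl.lex_of_idx_le h with h | ⟨h, hij⟩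
    · exact (pl.toll_lt_of_phase_lt h (h.le.trans hl) i j).le
    · rw [h, toll, toll, if_pos hl, if_pos hl]
      apply ENNReal.ofReal_le_ofReal
      have := pl.base_pos' (pl.phase j b)
      have : ((i : ℕ) : ℝ) ≤ (j : ℕ) := by exact_mod_cast hij
      gcongr
  · rw [toll, toll, if_neg hl]
    exact le_top

lemma toll_lt_of_idx_lt {i j : Fin m} {a b : ℕ} (h : pl.idx i a < pl.idx j b)
    (hl : pl.phase j b ≤ pl.last) : pl.toll (pl.phase i a) i < pl.toll (pl.phase j b) j := by
  rcases pl.lex_of_idx_le h.le with h' | ⟨h', hij⟩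
  · exact pl.toll_lt_of_phase_lt h' (h'.le.trans hl) i j
  · have hne : i ≠ j := by
      rintro rfl
      rw [idx, idx, h'] at h
      exact lt_irrefl _ h
    rw [h', toll, toll, if_pos hl, if_pos hl]
    have h1 := pl.base_pos' (pl.phase j b)
    have h2 : ((i : ℕ) : ℝ) < (j : ℕ) := by exact_mod_cast lt_of_le_of_ne hij hne
    have h3 : (0 : ℝ) < m := by exact_mod_cast i.pos
    apply (ENNReal.ofReal_lt_ofReal_iff (by positivity)).2
    gcongr

lemma cost_le_toll (hc : ∀ j, Monotone (c j)) (j : Fin m) (ℓ : ℕ) :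
    c j ℓ ≤ pl.toll (pl.phase j ℓ) j := by
  by_cases hl : pl.phase j ℓ ≤ pl.last
  · calc c j ℓ ≤ c j (pl.cap (pl.phase j ℓ + 1) j) := hc j (pl.le_cap_phase j ℓ)
      _ ≤ ∑ i, c i (pl.cap (pl.phase j ℓ + 1) i) :=
        Finset.single_le_sum (f := fun i => c i (pl.cap (pl.phase j ℓ + 1) i))
          (fun _ _ => zero_le) (Finset.mem_univ j)
      _ ≤ _ := (pl.cost_le _ hl).trans (pl.base_le_toll _ j)
  · rw [toll, if_neg hl]
    exact le_top

/-- Phases in which more than `b` machines grow. -/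
def Big (b φ : ℕ) : Prop :=
  φ ≤ pl.last ∧ b < (Finset.univ.filter fun j => pl.cap φ j < pl.cap (φ + 1) j).card

open Classical in
/-- The number of big phases before `φ`. -/
noncomputable def tier (b φ : ℕ) : ℕ := ((Finset.range φ).filter (pl.Big b)).card

open Classical in
lemma tier_mono (b : ℕ) : Monotone (pl.tier b) := fun _ _ h =>
  Finset.card_le_card (Finset.filter_subset_filter _ (Finset.range_mono h))

open Classical in
lemma tier_succ (b φ : ℕ) : pl.tier b (φ + 1) = pl.tier b φ + if pl.Big b φ then 1 else 0 := by
  rw [tier, tier, Finset.range_add_one, Finset.filter_insert]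
  split_ifs
  · rw [Finset.card_insert_of_notMem (by simp)]
  · rfl

/-- The last big phase before `φ` already has the full count; it supplies more than `b` machines of
the corresponding level. -/
lemma exists_big_of_tier_pos {b φ : ℕ} (h : 0 < pl.tier b φ) :
    ∃ ψ < φ, pl.Big b ψ ∧ pl.tier b φ = pl.tier b (ψ + 1) := by
  classical
  induction φ with
  | zero => simp [tier] at h
  | succ φ ih =>
    by_cases hb : pl.Big b φ
    · exact ⟨φ, Nat.lt_succ_self φ, hb, rfl⟩
    · have he : pl.tier b (φ + 1) = pl.tier b φ := by rw [pl.tier_succ, if_neg hb, add_zero]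
      obtain ⟨ψ, h1, h2, h3⟩ := ih (he ▸ h)
      exact ⟨ψ, h1.trans (Nat.lt_succ_self φ), h2, he.trans h3⟩

open Classical in
/-- The attractiveness of load `ℓ` on machine `j` for an agent that is the only leader there. -/
noncomputable def level (b : ℕ) (j : Fin m) (ℓ : ℕ) : ℕ :=
  if ℓ ≤ 1 then 0
  -- First slot of a block: one less than the level of the full machine before the move, so at equal
  -- tier a sole leader gains nothing by coming, while one from a smaller tier does.
  else if pl.Full j (ℓ - 1) then 2 * pl.tier b (pl.phase j (ℓ - 1) + 1) - 1
  -- Second slot of a block: its own phase is not counted yet, so that a frontier machine which has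
  -- just started a block does not attract leaders. From the third slot on it is counted.
  else if ℓ = 2 ∨ pl.Full j (ℓ - 2) then 2 * pl.tier b (pl.phase j ℓ)
  else 2 * pl.tier b (pl.phase j ℓ + 1)

lemma level_one (b : ℕ) (j : Fin m) : pl.level b j 1 = 0 := by simp [level]

lemma level_le (b : ℕ) (j : Fin m) (ℓ : ℕ) : pl.level b j ℓ ≤ 2 * pl.tier b (pl.phase j ℓ + 1) := by
  unfold level
  have h1 := pl.tier_mono b (Nat.succ_le_succ (pl.phase_mono j (Nat.sub_le ℓ 1)))
  have h2 := pl.tier_mono b (Nat.le_succ (pl.phase j ℓ))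
  simp only [Nat.succ_eq_add_one] at h1 h2
  split_ifs <;> omega

lemma level_succ_of_full (b : ℕ) {j : Fin m} {ℓ : ℕ} (h : pl.Full j ℓ) (h0 : 0 < ℓ) :
    pl.level b j (ℓ + 1) = 2 * pl.tier b (pl.phase j ℓ + 1) - 1 := by
  rw [level, if_neg (by omega), Nat.add_sub_cancel, if_pos h]

variable {pl} in
lemma Full.not_full_sub {j : Fin m} {ℓ k : ℕ} (h : pl.Full j ℓ) (hk : k < ℓ) (hk' : ℓ ≤ k + 3) :
    ¬ pl.Full j k := by
  have h0 : 0 < ℓ := by omega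
  rw [Full, not_not, (h.four_le h0).2 k hk' hk.le, (h.four_le h0).2 (k + 1) (by omega) (by omega)]

lemma level_of_full (b : ℕ) {j : Fin m} {ℓ : ℕ} (h : pl.Full j ℓ) (h0 : 0 < ℓ) :
    pl.level b j ℓ = 2 * pl.tier b (pl.phase j ℓ + 1) := by
  have h4 := (h.four_le h0).1
  rw [level, if_neg (by omega), if_neg (h.not_full_sub (by omega) (by omega)), if_neg]
  rintro (h' | h')
  · omega
  · exact h.not_full_sub (by omega) (by omega) h'

end Plan

/-! ### Leaders, regular agents and the cost shares -/

section Roles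

variable {N : Type*} (grp : N → ℕ) (e : N → ℕ)

/-- The agents of `T` that belong to one of the groups of leaders. -/
def leaders (T : Finset N) : Finset N := T.filter fun i => grp i ≠ 0

/-- The agents of `T` that are not leaders. -/
def regulars (T : Finset N) : Finset N := T.filter fun i => grp i = 0

variable {grp} in
@[simp] lemma mem_leaders {T : Finset N} {i : N} : i ∈ leaders grp T ↔ i ∈ T ∧ grp i ≠ 0 :=
  Finset.mem_filter

variable {grp} in
@[simp] lemma mem_regulars {T : Finset N} {i : N} : i ∈ regulars grp T ↔ i ∈ T ∧ grp i = 0 :=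
  Finset.mem_filter

lemma card_regulars_add_card_leaders (T : Finset N) :
    (regulars grp T).card + (leaders grp T).card = T.card :=
  Finset.card_filter_add_card_filter_not _

/-- The leaders of `T` are three agents from one group. -/
def IsTriple (T : Finset N) : Prop :=
  (leaders grp T).card = 3 ∧ ∀ a ∈ leaders grp T, ∀ b ∈ leaders grp T, grp a = grp b

/-- `i` comes first among the regular agents of `T`. -/
def IsFirst (T : Finset N) (i : N) : Prop := ∀ r ∈ regulars grp T, e i ≤ e r

/-- `i` comes last among the regular agents of `T`. -/
def IsLast (T : Finset N) (i : N) : Prop := ∀ r ∈ regulars grp T, e r ≤ e i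

end Roles

namespace Plan

variable {N : Type*} {m n₀ : ℕ} {c : Fin m → ℕ → ℝ≥0∞} (pl : Plan m c n₀)
  (b : ℕ) (grp : N → ℕ) (e : N → ℕ)

open Classical in
/-- What is paid in total on machine `j` when it is used by regular agents only and the block of
phase `φ` is used up. -/
noncomputable def blockPrice (φ : ℕ) (j : Fin m) : ℝ≥0∞ :=
  -- Many tolls in a big phase could far exceed the phase's budget, whereas the true costs of all
  -- machines together respect it.
  if pl.Big b φ then c j (pl.cap (φ + 1) j) else pl.toll φ j

/-- What is paid by an agent who is the only leader on machine `j` with load `ℓ`. -/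
noncomputable def leaderPrice (j : Fin m) (ℓ : ℕ) : ℝ≥0∞ :=
  if pl.level b j ℓ = 0 then pl.toll (pl.phase j ℓ) j
  -- Positive levels are priced below `base 0`, hence below every toll, and higher levels are
  -- strictly cheaper.
  else ENNReal.ofReal (pl.base 0 / (pl.level b j ℓ + 1))

open Classical in
/-- The cost shares. -/
noncomputable def share : ShareRule N m := fun j T i =>
  if grp i ≠ 0 then
    if (leaders grp T).card = 1 then pl.leaderPrice b j T.card
    -- The bound 4 guarantees a regular agent next to the three leaders, who covers the cost.
    else if IsTriple grp T ∧ 4 ≤ T.card ∧ pl.Full j T.card then 0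
    else pl.toll (pl.phase j T.card) j
  else if leaders grp T = ∅ ∧ pl.Full j T.card then
    if IsFirst grp e T i then pl.blockPrice b (pl.phase j T.card) j else 0
  -- Both extremes pay: in an assignment sorted by `e`, a regular agent who changes machine becomes
  -- first or last there and so faces the toll.
  else if IsFirst grp e T i ∨ IsLast grp e T i then pl.toll (pl.phase j T.card) j else 0

lemma blockPrice_le (φ : ℕ) (j : Fin m) : pl.blockPrice b φ j ≤ pl.toll φ j := by
  unfold blockPrice
  split_ifs with h
  · calc c j (pl.cap (φ + 1) j) ≤ ∑ i, c i (pl.cap (φ + 1) i) :=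
        Finset.single_le_sum (f := fun i => c i (pl.cap (φ + 1) i))
          (fun _ _ => zero_le) (Finset.mem_univ j)
      _ ≤ _ := (pl.cost_le _ h.1).trans (pl.base_le_toll _ j)
  · exact le_rfl

lemma ofReal_base_zero_le_toll (φ : ℕ) (j : Fin m) : ENNReal.ofReal (pl.base 0) ≤ pl.toll φ j :=
  (ENNReal.ofReal_le_ofReal (pl.base_mono (Nat.zero_le φ))).trans (pl.base_le_toll φ j)

lemma levelPrice_lt {g : ℕ} (hg : g ≠ 0) :
    ENNReal.ofReal (pl.base 0 / (g + 1)) < ENNReal.ofReal (pl.base 0) := by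
  have h0 := pl.base_pos
  have h1 : (0 : ℝ) < g := by exact_mod_cast Nat.pos_of_ne_zero hg
  apply (ENNReal.ofReal_lt_ofReal_iff h0).2
  rw [div_lt_iff₀ (by positivity)]
  nlinarith

lemma levelPrice_lt_levelPrice {g g' : ℕ} (h : g < g') :
    ENNReal.ofReal (pl.base 0 / (g' + 1)) < ENNReal.ofReal (pl.base 0 / (g + 1)) := by
  have h0 := pl.base_pos
  have h1 : (g : ℝ) < g' := by exact_mod_cast h
  apply (ENNReal.ofReal_lt_ofReal_iff (by positivity)).2
  gcongr

lemma leaderPrice_le (j : Fin m) (ℓ : ℕ) : pl.leaderPrice b j ℓ ≤ pl.toll (pl.phase j ℓ) j := by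
  unfold leaderPrice
  split_ifs with h
  · exact le_rfl
  · exact (pl.levelPrice_lt h).le.trans (pl.ofReal_base_zero_le_toll _ j)

lemma share_le (j : Fin m) (T : Finset N) (i : N) :
    pl.share b grp e j T i ≤ pl.toll (pl.phase j T.card) j := by
  unfold share
  split_ifs
  exacts [pl.leaderPrice_le b j _, zero_le, le_rfl, pl.blockPrice_le b _ j, zero_le, le_rfl,
    zero_le]

variable {grp e} in
lemma exists_isFirst {T : Finset N} (h : (regulars grp T).Nonempty) :
    ∃ i ∈ T, grp i = 0 ∧ IsFirst grp e T i := by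
  obtain ⟨i, hi, hmin⟩ := Finset.exists_min_image _ e h
  exact ⟨i, (mem_regulars.1 hi).1, (mem_regulars.1 hi).2, hmin⟩

lemma cost_le_blockPrice (hc : ∀ j, Monotone (c j)) {j : Fin m} {ℓ : ℕ} (h : pl.Full j ℓ) :
    c j ℓ ≤ pl.blockPrice b (pl.phase j ℓ) j := by
  unfold blockPrice
  split_ifs
  · rw [← h.eq_cap]
  · exact pl.cost_le_toll hc j ℓ

/-- One agent covers the cost alone: the first regular one or, among leaders only, any of them. In
the latter case a sole leader has load 1 and level 0, and a triple has load 3, so no discount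
applies. -/
lemma cost_le_sum_share (hc : ∀ j, Monotone (c j)) (hc0 : ∀ j, c j 0 = 0) (j : Fin m)
    (T : Finset N) : c j T.card ≤ ∑ i ∈ T, pl.share b grp e j T i := by
  classical
  have key : ∀ i ∈ T, c j T.card ≤ pl.share b grp e j T i →
      c j T.card ≤ ∑ i ∈ T, pl.share b grp e j T i := fun i hi h =>
    h.trans (Finset.single_le_sum (fun _ _ => zero_le) hi)
  by_cases hR : (regulars grp T).Nonempty
  · obtain ⟨i, hi, hg, hf⟩ := exists_isFirst (e := e) hR
    refine key i hi ?_
    rw [share, if_neg (by simpa using hg)]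
    split_ifs with h1 h2
    · exact pl.cost_le_blockPrice b hc h1.2
    · exact pl.cost_le_toll hc j _
    · exact absurd (Or.inl hf) h2
  · rcases T.eq_empty_or_nonempty with rfl | ⟨i, hi⟩
    · simp [hc0]
    · refine key i hi ?_
      have hTL := card_regulars_add_card_leaders grp T
      rw [Finset.not_nonempty_iff_eq_empty.1 hR, Finset.card_empty, zero_add] at hTL
      have hg : grp i ≠ 0 := fun h => hR ⟨i, mem_regulars.2 ⟨hi, h⟩⟩
      rw [share, if_pos hg]
      split_ifs with h1 h2
      · rw [leaderPrice, if_pos]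
        · exact pl.cost_le_toll hc j _
        · rw [← hTL, h1, pl.level_one]
      · have := h2.1.1
        omega
      · exact pl.cost_le_toll hc j _

lemma share_ne_top {j : Fin m} {T : Finset N} (hT : T.card ≤ n₀) (hfin : c j T.card ≠ ∞) (i : N) :
    pl.share b grp e j T i ≠ ∞ :=
  ne_top_of_le_ne_top
    (pl.toll_ne_top (pl.phase_le_iff.2 (pl.finite_le j _ hT hfin)) j) (pl.share_le b grp e j T i)

end Plan

/-! ### Sorted assignments and a criterion for equilibria -/

lemma exists_top {α : Type*} [DecidableEq α] (A : Finset α) (key : α → ℕ) :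
    ∀ k ≤ A.card, ∃ U ⊆ A, U.card = k ∧ ∀ u ∈ U, ∀ x ∈ A, x ∉ U → key x ≤ key u := by
  intro k
  induction k with
  | zero => exact fun _ => ⟨∅, by simp, by simp, by simp⟩
  | succ k ih =>
    intro hk
    obtain ⟨U, hUA, hU, hmax⟩ := ih (by omega)
    have hne : (A \ U).Nonempty := by
      rw [← Finset.card_pos, Finset.card_sdiff_of_subset hUA]
      omega
    obtain ⟨a, ha, hamax⟩ := Finset.exists_max_image _ key hne
    obtain ⟨haA, haU⟩ := Finset.mem_sdiff.1 ha
    refine ⟨insert a U, Finset.insert_subset haA hUA, by rw [Finset.card_insert_of_notMem haU, hU],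
      fun u hu x hx hxU => ?_⟩
    rw [Finset.mem_insert, not_or] at hxU
    rcases Finset.mem_insert.1 hu with rfl | hu
    · exact hamax x (Finset.mem_sdiff.2 ⟨hx, hxU.2⟩)
    · exact hmax u hu x hx hxU.2

/-- The target of highest rank takes the agents with the largest `e`; the rest follows by induction.
-/
lemma exists_monotone_assignment {α β : Type*} [DecidableEq α] [DecidableEq β] [Nonempty β] (e : α → ℕ)
    (rank : β → ℕ) (J : Finset β) :
    ∀ (A : Finset α) (ρ : β → ℕ), ∑ j ∈ J, ρ j = A.card →
      ∃ f : α → β, (∀ a ∈ A, f a ∈ J) ∧ (∀ j ∈ J, (A.filter fun a => f a = j).card = ρ j) ∧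
        ∀ a ∈ A, ∀ a' ∈ A, rank (f a) < rank (f a') → e a ≤ e a' := by
  induction J using Finset.induction_on_max_value rank with
  | empty =>
    intro A ρ h
    have hA : A = ∅ := Finset.card_eq_zero.1 (by simpa using h.symm)
    subst hA
    exact ⟨fun _ => Classical.arbitrary β, by simp, by simp, by simp⟩
  | insert j J hj hmax ih =>
    intro A ρ h
    rw [Finset.sum_insert hj] at h
    obtain ⟨U, hUA, hU, htop⟩ := exists_top A e (ρ j) (by omega)
    obtain ⟨f, hf1, hf2, hf3⟩ := ih (A \ U) ρ (by rw [Finset.card_sdiff_of_subset hUA]; omega)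
    have hfU : ∀ a ∈ A, a ∉ U → f a ≠ j := fun a ha haU h' =>
      hj (h' ▸ hf1 a (Finset.mem_sdiff.2 ⟨ha, haU⟩))
    refine ⟨fun a => if a ∈ U then j else f a, fun a ha => ?_, fun i hi => ?_,
      fun a ha a' ha' hr => ?_⟩
    · dsimp only
      split_ifs with haU
      · exact Finset.mem_insert_self _ _
      · exact Finset.mem_insert_of_mem (hf1 a (Finset.mem_sdiff.2 ⟨ha, haU⟩))
    · rcases Finset.mem_insert.1 hi with rfl | hiJ
      · rw [← hU]
        congr 1
        ext a
        simp only [Finset.mem_filter]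
        constructor
        · rintro ⟨ha, h'⟩
          by_contra haU
          rw [if_neg haU] at h'
          exact hfU a ha haU h'
        · exact fun haU => ⟨hUA haU, if_pos haU⟩
      · rw [← hf2 i hiJ]
        congr 1
        ext a
        simp only [Finset.mem_filter, Finset.mem_sdiff]
        have hij : j ≠ i := fun h' => hj (h' ▸ hiJ)
        by_cases haU : a ∈ U <;> simp [haU, hij]
    · by_cases haU : a ∈ U <;> by_cases haU' : a' ∈ U
      · simp [haU, haU'] at hr
      · simp only [haU, haU', if_true, if_false] at hr
        have := hmax _ (hf1 a' (Finset.mem_sdiff.2 ⟨ha', haU'⟩))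
        omega
      · exact htop a' haU' a ha haU
      · simp only [haU, haU', if_false] at hr
        exact hf3 a (Finset.mem_sdiff.2 ⟨ha, haU⟩) a' (Finset.mem_sdiff.2 ⟨ha', haU'⟩) hr

/-- The agents of `S` that `f` sends to machine `j`. -/
def usersOf {N : Type*} {m : ℕ} (f : N → Fin m) (S : Finset N) (j : Fin m) : Finset N :=
  S.filter fun i => f i = j

section

variable {N : Type*} {m : ℕ} {f : N → Fin m} {S : Finset N} {grp : N → ℕ}

@[simp] lemma mem_usersOf {i : N} {j : Fin m} : i ∈ usersOf f S j ↔ i ∈ S ∧ f i = j :=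
  Finset.mem_filter

lemma sum_card_usersOf : ∑ j, (usersOf f S j).card = S.card :=
  (Finset.card_eq_sum_card_fiberwise (fun _ _ => Finset.mem_coe.2 (Finset.mem_univ _))).symm

lemma exists_assignment [DecidableEq N] [Nonempty (Fin m)] (e : N → ℕ) (rank : Fin m → ℕ)
    (ℓ : Fin m → ℕ) (hℓ : ∑ j, ℓ j = S.card) (g : N → Fin m)
    (hg : ∀ j, (usersOf g (leaders grp S) j).card ≤ ℓ j) :
    ∃ f : N → Fin m, (∀ j, (usersOf f S j).card = ℓ j) ∧
      (∀ j, leaders grp (usersOf f S j) = usersOf g (leaders grp S) j) ∧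
      ∀ a ∈ S, grp a = 0 → ∀ a' ∈ S, grp a' = 0 → rank (f a) < rank (f a') → e a ≤ e a' := by
  obtain ⟨h, -, h2, h3⟩ := exists_monotone_assignment e rank Finset.univ (regulars grp S)
    (fun j => ℓ j - (usersOf g (leaders grp S) j).card) (by
      rw [Finset.sum_tsub_distrib _ (fun j _ => hg j), hℓ, sum_card_usersOf,
        ← card_regulars_add_card_leaders grp S, Nat.add_sub_cancel])
  have hL : ∀ j, leaders grp (usersOf (fun i => if grp i = 0 then h i else g i) S j) =
      usersOf g (leaders grp S) j := by
    intro j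
    ext i
    simp only [mem_leaders, mem_usersOf]
    by_cases hi : grp i = 0 <;> simp [hi]
  refine ⟨fun i => if grp i = 0 then h i else g i, fun j => ?_, hL, ?_⟩
  · rw [← card_regulars_add_card_leaders grp, hL]
    have hR : regulars grp (usersOf (fun i => if grp i = 0 then h i else g i) S j) =
        (regulars grp S).filter fun i => h i = j := by
      ext i
      simp only [mem_regulars, mem_usersOf, Finset.mem_filter]
      by_cases hi : grp i = 0 <;> simp [hi]
    rw [hR, h2 j (Finset.mem_univ j)]
    have := hg j
    omega
  · intro a ha hga a' ha' hga' hr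
    simp only [hga, hga', if_true] at hr
    exact h3 a (mem_regulars.2 ⟨ha, hga⟩) a' (mem_regulars.2 ⟨ha', hga'⟩) hr

lemma users_restrict [DecidableEq N] (j : Fin m) :
    users (fun i : S => f i) j = usersOf f S j := by
  ext i
  simp [users, and_comm]

lemma users_update [DecidableEq N] (s : S → Fin m) (i : S) {j : Fin m} :
    users (Function.update s i j) j = insert (i : N) (users s j) := by
  ext a
  simp only [users, Finset.mem_map, Finset.mem_filter, Finset.mem_univ, true_and,
    Function.Embedding.subtype_apply, Finset.mem_insert, Subtype.exists, exists_and_right,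
    exists_eq_right]
  by_cases ha : a = i
  · subst ha
    simp
  · simp only [ha, false_or]
    refine exists_congr fun haS => ?_
    rw [Function.update_of_ne]
    exact fun h' => ha (congrArg Subtype.val h')

lemma isPNE_of_forall [DecidableEq N] {ξ : ShareRule N m}
    (h : ∀ i ∈ S, ∀ j, f i ≠ j →
      ξ (f i) (usersOf f S (f i)) i ≤ ξ j (insert i (usersOf f S j)) i) :
    IsPNE ξ (fun i : S => f i) := by
  intro i j
  by_cases hj : f i = j
  · rw [← hj, Function.update_eq_self]
  · rw [agentShare, agentShare, Function.update_self, users_update, users_restrict,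
      users_restrict]
    exact h i i.2 j hj

end

namespace Plan

variable {N : Type*} [DecidableEq N] {m n₀ : ℕ} {c : Fin m → ℕ → ℝ≥0∞} (pl : Plan m c n₀)
  (b : ℕ) (grp : N → ℕ) (e : N → ℕ)

lemma not_full_one (j : Fin m) : ¬ pl.Full j 1 := fun h => by
  have := (h.four_le one_pos).1
  omega

/-- Sufficient conditions for a pure Nash equilibrium. -/
lemma share_le_of_balanced {S : Finset N} {f : N → Fin m} {rank : Fin m → ℕ}
    (hrank : Function.Injective rank)
    (hbal : ∀ i j, (usersOf f S i).Nonempty →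
      ¬ (leaders grp (usersOf f S j) = ∅ ∧ pl.Full j ((usersOf f S j).card + 1)) →
      pl.idx i (usersOf f S i).card ≤ pl.idx j ((usersOf f S j).card + 1))
    (hmono : ∀ a ∈ S, grp a = 0 → ∀ a' ∈ S, grp a' = 0 → rank (f a) < rank (f a') → e a ≤ e a')
    (hreg : ∀ i ∈ S, grp i = 0 → ∀ j, f i ≠ j → (usersOf f S j).Nonempty →
      leaders grp (usersOf f S j) = ∅ → pl.Full j ((usersOf f S j).card + 1) →
      pl.share b grp e (f i) (usersOf f S (f i)) i ≤
        pl.share b grp e j (insert i (usersOf f S j)) i)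
    (hlead : ∀ i ∈ S, grp i ≠ 0 → pl.share b grp e (f i) (usersOf f S (f i)) i = 0 ∨
      ∀ j, f i ≠ j →
        (leaders grp (usersOf f S j) = ∅ → (usersOf f S j).Nonempty →
          pl.share b grp e (f i) (usersOf f S (f i)) i ≤
            pl.leaderPrice b j ((usersOf f S j).card + 1)) ∧
        ¬ (IsTriple grp (insert i (usersOf f S j)) ∧ pl.Full j ((usersOf f S j).card + 1) ∧
          4 ≤ (usersOf f S j).card + 1)) :
    IsPNE (pl.share b grp e) (fun i : S => f i) := by
  apply isPNE_of_forall
  intro i hi j hj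
  have hnot : i ∉ usersOf f S j := fun h => hj (mem_usersOf.1 h).2
  have hcard : (insert i (usersOf f S j)).card = (usersOf f S j).card + 1 :=
    Finset.card_insert_of_notMem hnot
  have htoll : ¬ (leaders grp (usersOf f S j) = ∅ ∧ pl.Full j ((usersOf f S j).card + 1)) →
      pl.share b grp e (f i) (usersOf f S (f i)) i ≤
        pl.toll (pl.phase j ((usersOf f S j).card + 1)) j := fun h =>
    (pl.share_le b grp e _ _ _).trans
      (pl.toll_le_of_idx_le (hbal _ _ ⟨i, mem_usersOf.2 ⟨hi, rfl⟩⟩ h))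
  by_cases hg : grp i = 0
  · have hins : leaders grp (insert i (usersOf f S j)) = leaders grp (usersOf f S j) := by
      rw [leaders, leaders, Finset.filter_insert, if_neg (by simpa using hg)]
    by_cases hcalm : leaders grp (usersOf f S j) = ∅ ∧ pl.Full j ((usersOf f S j).card + 1)
    · refine hreg i hi hg j hj ?_ hcalm.1 hcalm.2
      by_contra hne
      rw [Finset.not_nonempty_iff_eq_empty] at hne
      rw [hne] at hcalm
      exact pl.not_full_one j hcalm.2
    · conv_rhs => rw [share]
      rw [if_neg (by simpa using hg), hins, hcard, if_neg hcalm, if_pos]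
      · exact htoll hcalm
      -- By sortedness the mover is first among the regular agents of a machine of higher rank and
      -- last on one of lower rank.
      · have hr : rank (f i) ≠ rank j := fun h => hj (hrank h)
        have hmem : ∀ r ∈ regulars grp (insert i (usersOf f S j)),
            r = i ∨ (r ∈ S ∧ grp r = 0 ∧ f r = j) := by
          intro r hr
          obtain ⟨h1, h2⟩ := mem_regulars.1 hr
          rcases Finset.mem_insert.1 h1 with h1 | h1
          · exact Or.inl h1
          · exact Or.inr ⟨(mem_usersOf.1 h1).1, h2, (mem_usersOf.1 h1).2⟩
        rcases lt_or_gt_of_ne hr with hr | hr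
        · left
          intro r hrm
          rcases hmem r hrm with rfl | ⟨h1, h2, h3⟩
          · exact le_rfl
          · exact hmono i hi hg r h1 h2 (by rw [h3]; exact hr)
        · right
          intro r hrm
          rcases hmem r hrm with rfl | ⟨h1, h2, h3⟩
          · exact le_rfl
          · exact hmono r h1 h2 i hi hg (by rw [h3]; exact hr)
  · rcases hlead i hi hg with h0 | hlead
    · rw [h0]
      exact zero_le
    · obtain ⟨h1, h2⟩ := hlead j hj
      conv_rhs => rw [share]
      rw [if_pos hg, hcard]
      have hins : (leaders grp (insert i (usersOf f S j))).card =
          (leaders grp (usersOf f S j)).card + 1 := by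
        rw [leaders, Finset.filter_insert, if_pos hg,
          Finset.card_insert_of_notMem (fun h => hnot (Finset.mem_filter.1 h).1), leaders]
      split_ifs with h3 h4
      · have hempty : leaders grp (usersOf f S j) = ∅ :=
          Finset.card_eq_zero.1 (by omega)
        rcases (usersOf f S j).eq_empty_or_nonempty with he | hne
        · rw [he] at htoll ⊢
          rw [leaderPrice, if_pos (by simp [level_one])]
          exact htoll fun h => pl.not_full_one j h.2
        · exact h1 hempty hne
      · exact absurd ⟨h4.1, h4.2.2, h4.2.1⟩ h2
      · refine htoll fun h => h3 ?_
        rw [hins, h.1, Finset.card_empty]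

end Plan

/-! ### Greedy filling and equilibria without leaders -/

namespace Plan

variable {m n₀ : ℕ} {c : Fin m → ℕ → ℝ≥0∞} (pl : Plan m c n₀)

/-- Machine `k` is the one that was filled last when the slots are used in the order of their blocks,
up to loads `ℓ`. -/
structure IsFrontier (ℓ : Fin m → ℕ) (k : Fin m) : Prop where
  pos : 0 < ℓ k
  le : ∀ i, 0 < ℓ i → pl.idx i (ℓ i) ≤ pl.idx k (ℓ k)
  le_succ : ∀ j, pl.idx k (ℓ k) ≤ pl.idx j (ℓ j + 1)

/-- Greedy filling: each further agent takes the next slot of smallest block index. -/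
lemma exists_balanced [Nonempty (Fin m)] (n : ℕ) : ∃ ℓ : Fin m → ℕ, ∑ j, ℓ j = n ∧
    ∀ i j, 0 < ℓ i → pl.idx i (ℓ i) ≤ pl.idx j (ℓ j + 1) := by
  induction n with
  | zero => exact ⟨fun _ => 0, by simp, by simp⟩
  | succ n ih =>
    obtain ⟨ℓ, hs, hb⟩ := ih
    obtain ⟨k, hk⟩ := Finite.exists_min fun j => pl.idx j (ℓ j + 1)
    have hle : ∀ j, ℓ j ≤ Function.update ℓ k (ℓ k + 1) j := by
      intro j
      by_cases hj : j = k
      · subst hj; simp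
      · simp [hj]
    refine ⟨Function.update ℓ k (ℓ k + 1), ?_, fun i j hi => ?_⟩
    · rw [Finset.sum_update_of_mem (Finset.mem_univ k), ← hs,
        ← Finset.add_sum_erase _ _ (Finset.mem_univ k), Finset.sdiff_singleton_eq_erase]
      omega
    · refine le_trans ?_ (pl.idx_mono j (Nat.succ_le_succ (hle j)))
      by_cases hik : i = k
      · subst hik
        simpa using hk j
      · rw [Function.update_of_ne hik] at hi ⊢
        exact hb i j hi

lemma exists_frontier [Nonempty (Fin m)] {n : ℕ} (hn : 0 < n) :
    ∃ ℓ : Fin m → ℕ, ∑ j, ℓ j = n ∧ ∃ k, pl.IsFrontier ℓ k := by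
  obtain ⟨ℓ, hs, hb⟩ := pl.exists_balanced n
  have hne : (Finset.univ.filter fun j => 0 < ℓ j).Nonempty := by
    by_contra h
    rw [Finset.not_nonempty_iff_eq_empty, Finset.filter_eq_empty_iff] at h
    have : ∑ j, ℓ j = 0 := Finset.sum_eq_zero fun j _ => by simpa using h (Finset.mem_univ j)
    omega
  obtain ⟨k, hk, hmax⟩ := Finset.exists_max_image _ (fun j => pl.idx j (ℓ j)) hne
  have hk0 := (Finset.mem_filter.1 hk).2
  exact ⟨ℓ, hs, k, hk0, fun i hi => hmax i (by simpa using hi), fun j => hb k j hk0⟩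

variable {pl} in
lemma Full.not_full_succ {j : Fin m} {ℓ : ℕ} (h : pl.Full j ℓ) :
    ¬ pl.Full j (ℓ + 1) := fun h' => h'.not_full_sub (by omega) (by omega) h

namespace IsFrontier

variable {pl} {ℓ : Fin m → ℕ} {k : Fin m} (hk : pl.IsFrontier ℓ k)

include hk

lemma idx_le (i j : Fin m) (hi : 0 < ℓ i) : pl.idx i (ℓ i) ≤ pl.idx j (ℓ j + 1) :=
  (hk.le i hi).trans (hk.le_succ j)

/-- Blocks of different machines have different indices, so the frontier block lies strictly after
the current block of `j` and not after the next slot of `j`. -/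
lemma full {j : Fin m} (hj : j ≠ k) (h0 : 0 < ℓ j) : pl.Full j (ℓ j) :=
  pl.full_of_idx_lt (((hk.le j h0).lt_of_ne fun h => hj (pl.idx_injective h)).trans_le
    (hk.le_succ j))

lemma eq_of_full_succ {j : Fin m} (h : pl.Full j (ℓ j + 1)) : j = k := by
  by_contra hj
  rcases Nat.eq_zero_or_pos (ℓ j) with h0 | h0
  · rw [h0] at h
    have := (h.four_le one_pos).1
    omega
  · exact (hk.full hj h0).not_full_succ h

end IsFrontier

variable {N : Type*} (b : ℕ) (grp : N → ℕ) (e : N → ℕ)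

open Classical in
lemma share_of_calm {T : Finset N} {i : N} {j : Fin m} (hg : grp i = 0) (hL : leaders grp T = ∅)
    (hF : pl.Full j T.card) : pl.share b grp e j T i =
      if IsFirst grp e T i then pl.blockPrice b (pl.phase j T.card) j else 0 := by
  rw [share, if_neg (by simpa using hg), if_pos ⟨hL, hF⟩]

lemma usersOf_nonempty_iff {f : N → Fin m} {S : Finset N} {ℓ : Fin m → ℕ}
    (h : ∀ j, (usersOf f S j).card = ℓ j) (j : Fin m) : (usersOf f S j).Nonempty ↔ 0 < ℓ j := by
  rw [← h j, Finset.card_pos]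

variable [DecidableEq N]

/-- No machine is one agent short of full, so no move leads to a block price, only to tolls at least
as high as the mover's share. -/
lemma exists_isPNE_of_not_full [Nonempty (Fin m)] {S : Finset N} (hL : leaders grp S = ∅)
    {ℓ : Fin m → ℕ} (hℓ : ∑ j, ℓ j = S.card) {k : Fin m} (hk : pl.IsFrontier ℓ k)
    (hhole : ¬ pl.Full k (ℓ k + 1)) :
    ∃ s : S → Fin m, IsPNE (pl.share b grp e) s := by
  obtain ⟨f, h1, h2, h3⟩ := exists_assignment (grp := grp) e (fun j : Fin m => (j : ℕ)) ℓ hℓ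
    (fun _ => k) (fun j => by simp [hL, usersOf])
  refine ⟨fun i => f i, pl.share_le_of_balanced b grp e Fin.val_injective (fun i j hi _ => ?_) h3
    (fun i _ _ j _ _ _ hfull => ?_) (fun i hi hg => ?_)⟩
  · rw [h1, h1]
    exact hk.idx_le i j ((usersOf_nonempty_iff h1 i).1 hi)
  · rw [h1] at hfull
    obtain rfl := hk.eq_of_full_succ hfull
    exact absurd hfull hhole
  · have : i ∈ leaders grp S := mem_leaders.2 ⟨hi, hg⟩
    simp [hL] at this

/-- One more agent on the frontier machine would make all used machines full. The vacancy is moved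
to the machine `H` of largest block price; whoever would fill it pays that price, which is at least
her present share. -/
lemma exists_isPNE_of_full [Nonempty (Fin m)] {S : Finset N} (hL : leaders grp S = ∅)
    {ℓ : Fin m → ℕ} (hℓ : ∑ j, ℓ j = S.card) {k : Fin m} (hk : pl.IsFrontier ℓ k)
    (hhole : pl.Full k (ℓ k + 1)) :
    ∃ s : S → Fin m, IsPNE (pl.share b grp e) s := by
  obtain ⟨ℓ', hℓ'⟩ : ∃ ℓ' : Fin m → ℕ, ℓ' = Function.update ℓ k (ℓ k + 1) := ⟨_, rfl⟩
  have hk' : ℓ' k = ℓ k + 1 := by simp [hℓ']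
  have hne' : ∀ j ≠ k, ℓ' j = ℓ j := fun j hj => by simp [hℓ', hj]
  have hsum' : ∑ j, ℓ' j = S.card + 1 := by
    rw [hℓ', Finset.sum_update_of_mem (Finset.mem_univ k), ← hℓ,
      ← Finset.add_sum_erase _ _ (Finset.mem_univ k), Finset.sdiff_singleton_eq_erase]
    omega
  have hfull : ∀ j, 0 < ℓ' j → pl.Full j (ℓ' j) := by
    intro j hj
    by_cases hjk : j = k
    · rw [hjk, hk']; exact hhole
    · rw [hne' j hjk] at hj ⊢
      exact hk.full hjk hj
  have hidx : ∀ i, 0 < ℓ' i → pl.idx i (ℓ' i) ≤ pl.idx k (ℓ k) := by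
    intro i hi
    by_cases hik : i = k
    · rw [hik, hk', pl.idx_succ_of_not_full]
      exact hhole.not_full_sub (by omega) (by omega)
    · rw [hne' i hik] at hi ⊢
      exact hk.le i hi
  obtain ⟨H, hH, hmax⟩ := Finset.exists_max_image (Finset.univ.filter fun j => 0 < ℓ' j)
    (fun j => pl.blockPrice b (pl.phase j (ℓ' j)) j) ⟨k, by simp [hk']⟩
  have hH0 : 0 < ℓ' H := by simpa using hH
  obtain ⟨d, hd⟩ : ∃ d : Fin m → ℕ, d = Function.update ℓ' H (ℓ' H - 1) := ⟨_, rfl⟩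
  have hdH : d H + 1 = ℓ' H := by simp [hd]; omega
  have hdne : ∀ j ≠ H, d j = ℓ' j := fun j hj => by simp [hd, hj]
  have hdle : ∀ j, d j ≤ ℓ' j := by
    intro j
    by_cases hj : j = H
    · rw [hj]; omega
    · rw [hdne j hj]
  have hdsum : ∑ j, d j = S.card := by
    rw [← Finset.add_sum_erase _ _ (Finset.mem_univ H)] at hsum'
    rw [hd, Finset.sum_update_of_mem (Finset.mem_univ H), Finset.sdiff_singleton_eq_erase]
    omega
  obtain ⟨f, h1, h2, h3⟩ := exists_assignment (grp := grp) e
    -- The top rank for `H` makes every regular newcomer the first one there, so that she is charged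
    -- the block price.
    (fun j : Fin m => if j = H then m else (j : ℕ)) d hdsum
    (fun _ => k) (fun j => by simp [hL, usersOf])
  have hcard : ∀ j, j ≠ H → (usersOf f S j).card = ℓ' j := fun j hj => by rw [h1, hdne j hj]
  have hlead : ∀ j, leaders grp (usersOf f S j) = ∅ := fun j => by
    rw [h2, hL]; rfl
  refine ⟨fun i => f i, pl.share_le_of_balanced b grp e (rank := fun j : Fin m => if j = H then m else (j : ℕ)) ?_ (fun i j hi hcalm => ?_) h3
    (fun i hi hg j hij hne _ hfl => ?_) (fun i hi hg => ?_)⟩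
  · intro i j hij
    have := i.isLt
    have := j.isLt
    dsimp only at hij
    split_ifs at hij with h h' h'
    · rw [h, h']
    · omega
    · omega
    · exact Fin.ext hij
  · have hj : j ≠ H := by
      rintro rfl
      refine hcalm ⟨hlead j, ?_⟩
      rw [h1, hdH]
      exact hfull j hH0
    have hi' : 0 < d i := (usersOf_nonempty_iff h1 i).1 hi
    rw [h1, h1, hdne j hj]
    refine (pl.idx_mono i (hdle i)).trans ((hidx i (hi'.trans_le (hdle i))).trans ?_)
    refine (hk.le_succ j).trans (pl.idx_mono j ?_)
    by_cases hjk : j = k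
    · rw [hjk, hk']; omega
    · rw [hne' j hjk]
  · have hj : j = H := by
      by_contra hj
      rw [hcard j hj] at hfl
      have hj0 : 0 < ℓ' j := by rw [← hcard j hj]; exact hne.card_pos
      exact (hfull j hj0).not_full_succ hfl
    subst hj
    have hnot : i ∉ usersOf f S j := fun h => hij (mem_usersOf.1 h).2
    have hins : leaders grp (insert i (usersOf f S j)) = ∅ := by
      rw [← hlead j, leaders, leaders, Finset.filter_insert, if_neg (by simpa using hg)]
    have hi0 : 0 < ℓ' (f i) := by
      rw [← hcard _ hij]
      exact Finset.card_pos.2 ⟨i, mem_usersOf.2 ⟨hi, rfl⟩⟩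
    have hfirst : IsFirst grp e (insert i (usersOf f S j)) i := by
      intro r hr
      obtain ⟨hr1, hr2⟩ := mem_regulars.1 hr
      rcases Finset.mem_insert.1 hr1 with rfl | hr1
      · exact le_rfl
      · refine h3 i hi hg r (mem_usersOf.1 hr1).1 hr2 ?_
        rw [(mem_usersOf.1 hr1).2, if_pos rfl, if_neg hij]
        exact (f i).isLt
    rw [pl.share_of_calm b grp e hg (hlead _) (by rw [hcard _ hij]; exact hfull _ hi0),
      pl.share_of_calm b grp e hg hins (by rwa [Finset.card_insert_of_notMem hnot]), if_pos hfirst,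
      Finset.card_insert_of_notMem hnot, h1, h1, hdH, hdne _ hij]
    split_ifs
    · exact hmax (f i) (by simpa using hi0)
    · exact zero_le
  · have : i ∈ leaders grp S := mem_leaders.2 ⟨hi, hg⟩
    simp [hL] at this

end Plan

/-! ### Equilibria with leaders -/

lemma exists_between_sum {α : Type*} [DecidableEq α] (J : Finset α) (lo hi : α → ℕ)
    (h : ∀ j ∈ J, lo j ≤ hi j) (t : ℕ) (hlo : ∑ j ∈ J, lo j ≤ t) (hhi : t ≤ ∑ j ∈ J, hi j) :
    ∃ ρ : α → ℕ, (∀ j ∈ J, lo j ≤ ρ j ∧ ρ j ≤ hi j) ∧ ∑ j ∈ J, ρ j = t := by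
  induction t, hlo using Nat.le_induction with
  | base => exact ⟨lo, fun j hj => ⟨le_rfl, h j hj⟩, rfl⟩
  | succ t _ ih =>
    obtain ⟨ρ, h1, h2⟩ := ih (by omega)
    obtain ⟨j, hj, hlt⟩ : ∃ j ∈ J, ρ j < hi j := by
      by_contra! hc
      have := Finset.sum_le_sum hc
      omega
    refine ⟨Function.update ρ j (ρ j + 1), fun i hi => ?_, ?_⟩
    · have := h1 i hi
      by_cases hij : i = j
      · subst hij
        simp only [Function.update_self]
        omega
      · rwa [Function.update_of_ne hij]
    · rw [Finset.sum_update_of_mem hj, ← h2, ← Finset.add_sum_erase _ _ hj,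
        Finset.sdiff_singleton_eq_erase]
      omega

/-- Three agents of one group occupy one element of `Z`, and removing them keeps all group sizes
divisible by 3. -/
lemma exists_triples {N β : Type*} [DecidableEq N] [DecidableEq β] [Nonempty β] (grp : N → ℕ) :
    ∀ (n : ℕ) (C : Finset N) (Z : Finset β), C.card = n → C.card ≤ Z.card →
      (∀ a ∈ C, 3 ∣ (C.filter fun i => grp i = grp a).card) →
      ∃ h : N → β, (∀ a ∈ C, h a ∈ Z) ∧ ∀ a ∈ C, (C.filter fun i => h i = h a).card = 3 ∧
        ∀ i ∈ C, h i = h a → grp i = grp a := by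
  intro n
  induction n using Nat.strong_induction_on with
  | _ n ih =>
    intro C Z hn hCZ hdiv
    rcases C.eq_empty_or_nonempty with rfl | ⟨a, ha⟩
    · exact ⟨fun _ => Classical.arbitrary β, by simp, by simp⟩
    · have h3 : 3 ≤ (C.filter fun i => grp i = grp a).card :=
        Nat.le_of_dvd (Finset.card_pos.2 ⟨a, by simp [ha]⟩) (hdiv a ha)
      obtain ⟨t, htsub, ht⟩ := Finset.exists_subset_card_eq h3
      have htC : t ⊆ C := htsub.trans (Finset.filter_subset _ _)
      have htg : ∀ i ∈ t, grp i = grp a := fun i hi => (Finset.mem_filter.1 (htsub hi)).2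
      obtain ⟨z, hz⟩ : Z.Nonempty := Finset.card_pos.1 (by
        have := Finset.card_pos.2 ⟨a, ha⟩
        omega)
      have hc := Finset.card_sdiff_of_subset htC
      have hcz := Finset.card_erase_of_mem hz
      have h3C := Finset.card_le_card htC
      obtain ⟨h, h1, h2⟩ := ih (C \ t).card (by omega) (C \ t) (Z.erase z) rfl (by omega) (by
        intro i hi
        have hiC := (Finset.mem_sdiff.1 hi).1
        have he : ((C \ t).filter fun x => grp x = grp i) =
            (C.filter fun x => grp x = grp i) \ (t.filter fun x => grp x = grp i) := by
          ext x
          simp only [Finset.mem_filter, Finset.mem_sdiff]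
          tauto
        rw [he, Finset.card_sdiff_of_subset (Finset.filter_subset_filter _ htC)]
        apply Nat.dvd_sub (hdiv i hiC)
        by_cases hia : grp i = grp a
        · rw [Finset.filter_true_of_mem fun x hx => (htg x hx).trans hia.symm, ht]
        · rw [Finset.filter_false_of_mem fun x hx h' => hia (h'.symm.trans (htg x hx))]
          simp)
      have hne : ∀ i ∈ C, i ∉ t → h i ≠ z := fun i hi hit =>
        (Finset.mem_erase.1 (h1 i (Finset.mem_sdiff.2 ⟨hi, hit⟩))).1
      refine ⟨fun i => if i ∈ t then z else h i, fun i hi => ?_, fun i hi => ?_⟩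
      · dsimp only
        split_ifs with hit
        · exact hz
        · exact (Finset.mem_erase.1 (h1 i (Finset.mem_sdiff.2 ⟨hi, hit⟩))).2
      · by_cases hit : i ∈ t
        · have key : ∀ x ∈ C, (if x ∈ t then z else h x) = z ↔ x ∈ t := by
            intro x hx
            by_cases hxt : x ∈ t
            · simp [hxt]
            · simp [hxt, hne x hx hxt]
          simp only [if_pos hit]
          constructor
          · rw [Finset.filter_congr key, Finset.filter_mem_eq_inter,
              Finset.inter_eq_right.2 htC, ht]
          · intro x hx hxz
            rw [htg x ((key x hx).1 hxz), htg i hit]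
        · have key : ∀ x ∈ C, (if x ∈ t then z else h x) = h i ↔ x ∉ t ∧ h x = h i := by
            intro x hx
            by_cases hxt : x ∈ t
            · simp [hxt, (hne i hi hit).symm]
            · simp [hxt]
          simp only [if_neg hit]
          obtain ⟨h3, h4⟩ := h2 i (Finset.mem_sdiff.2 ⟨hi, hit⟩)
          constructor
          · rw [Finset.filter_congr key, ← h3]
            congr 1
            ext x
            simp only [Finset.mem_filter, Finset.mem_sdiff]
            tauto
          · intro x hx hxz
            have := (key x hx).1 hxz
            exact h4 x (Finset.mem_sdiff.2 ⟨hx, this.1⟩) this.2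

/-- From each non-empty group take 1, 2 or 3 agents, according to its size modulo 3. Taking 3 rather
than 0 keeps `W` non-empty. -/
lemma exists_remainder {N : Type*} [DecidableEq N] (grp : N → ℕ) {L : ℕ} {A : Finset N}
    (hA : ∀ i ∈ A, 1 ≤ grp i ∧ grp i ≤ L) (hne : A.Nonempty) :
    ∃ W ⊆ A, W.Nonempty ∧ W.card ≤ 3 * L ∧
      ∀ a ∈ A \ W, 3 ∣ ((A \ W).filter fun i => grp i = grp a).card := by
  have h : ∀ g, ∃ t ⊆ A.filter fun i => grp i = g,
      t.card = if (A.filter fun i => grp i = g).card = 0 then 0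
        else ((A.filter fun i => grp i = g).card - 1) % 3 + 1 := by
    intro g
    apply Finset.exists_subset_card_eq
    split_ifs with h
    · omega
    · have := Nat.mod_le ((A.filter fun i => grp i = g).card - 1) 3
      omega
  choose t ht hcard using h
  have hW : ∀ g, ((A.filter fun i => i ∈ t (grp i)).filter fun i => grp i = g) = t g := by
    intro g
    ext i
    simp only [Finset.mem_filter]
    constructor
    · rintro ⟨⟨_, h1⟩, rfl⟩
      exact h1
    · intro hi
      have := Finset.mem_filter.1 (ht g hi)
      refine ⟨⟨this.1, ?_⟩, this.2⟩
      rwa [this.2]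
  refine ⟨A.filter fun i => i ∈ t (grp i), Finset.filter_subset _ _, ?_, ?_, ?_⟩
  · obtain ⟨a, ha⟩ := hne
    have h0 : (A.filter fun i => grp i = grp a).card ≠ 0 :=
      (Finset.card_pos.2 ⟨a, by simp [ha]⟩).ne'
    have h1 := hcard (grp a)
    rw [if_neg h0] at h1
    obtain ⟨i, hi⟩ := Finset.card_pos.1 (show 0 < (t (grp a)).card by omega)
    rw [← hW] at hi
    exact ⟨i, (Finset.mem_filter.1 hi).1⟩
  · rw [Finset.card_eq_sum_card_fiberwise (f := grp) (t := Finset.Icc 1 L)]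
    · calc _ ≤ ∑ g ∈ Finset.Icc 1 L, 3 := Finset.sum_le_sum fun g _ => by
            rw [hW, hcard]
            split_ifs <;> omega
        _ = _ := by simp [mul_comm]
    · intro i hi
      have := hA i (Finset.mem_filter.1 hi).1
      simpa using this
  · intro a ha
    have he : ((A \ A.filter fun i => i ∈ t (grp i)).filter fun i => grp i = grp a) =
        (A.filter fun i => grp i = grp a) \ t (grp a) := by
      rw [← hW (grp a)]
      ext x
      simp only [Finset.mem_filter, Finset.mem_sdiff]
      tauto
    have h0 : (A.filter fun i => grp i = grp a).card ≠ 0 :=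
      (Finset.card_pos.2 ⟨a, by simp [(Finset.mem_sdiff.1 ha).1]⟩).ne'
    rw [he, Finset.card_sdiff_of_subset (ht _), hcard, if_neg h0]
    omega

namespace Plan

variable {m n₀ : ℕ} {c : Fin m → ℕ → ℝ≥0∞} (pl : Plan m c n₀)
variable {N : Type*} [DecidableEq N] (b : ℕ) (grp : N → ℕ) (e : N → ℕ)

variable {grp} in
lemma card_leaders_insert {T : Finset N} {i : N} (hg : grp i ≠ 0) (hi : i ∉ T) :
    (leaders grp (insert i T)).card = (leaders grp T).card + 1 := by
  rw [leaders, Finset.filter_insert, if_pos hg,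
    Finset.card_insert_of_notMem (fun h => hi (Finset.mem_filter.1 h).1), leaders]

variable {pl} in
-- The final alternative prevents a third leader from completing a free triple on the frontier
-- machine: there are not two leaders already, or load 3 is too small, or nobody can come from
-- elsewhere.
lemma exists_leader_loads {ℓ : Fin m → ℕ} {k : Fin m} (hk : pl.IsFrontier ℓ k) {β : ℕ}
    (hβ : (Finset.univ.filter fun j => 0 < ℓ j).card ≤ β) (hβn : β ≤ ∑ j, ℓ j) :
    ∃ ρ : Fin m → ℕ, (∀ j, ρ j ≤ ℓ j) ∧ (∀ j, 0 < ℓ j → 0 < ρ j) ∧ ∑ j, ρ j = β ∧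
      (ρ k ≠ 2 ∨ ℓ k = 2 ∨ ∀ j, 0 < ℓ j → j = k) := by
  have hk0 := hk.pos
  have hn : ∑ j, ℓ j = ℓ k + ∑ j ∈ Finset.univ.erase k, ℓ j :=
    (Finset.add_sum_erase _ _ (Finset.mem_univ k)).symm
  obtain ⟨O, hO⟩ : ∃ O, O = ∑ j ∈ Finset.univ.erase k, ℓ j := ⟨_, rfl⟩
  obtain ⟨v, hv⟩ : ∃ v, v = ∑ j ∈ Finset.univ.erase k, min 1 (ℓ j) := ⟨_, rfl⟩
  have hu : (Finset.univ.filter fun j => 0 < ℓ j).card = v + 1 := by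
    have h1 : (Finset.univ.filter fun j => 0 < ℓ j).card = ∑ j, min 1 (ℓ j) := by
      rw [Finset.card_filter]
      refine Finset.sum_congr rfl fun j _ => ?_
      split_ifs <;> omega
    rw [h1, hv, ← Finset.add_sum_erase _ _ (Finset.mem_univ k)]
    omega
  have hvO : 4 * v ≤ O := by
    rw [hv, hO, Finset.mul_sum]
    refine Finset.sum_le_sum fun j hj => ?_
    rcases Nat.eq_zero_or_pos (ℓ j) with h0 | h0
    · simp [h0]
    · have := ((hk.full (Finset.mem_erase.1 hj).1 h0).four_le h0).1
      omega
  rw [← hO] at hn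
  have hsingle : v = 0 → ∀ j, 0 < ℓ j → j = k := by
    intro h0 j hj
    by_contra hjk
    rw [hv, Finset.sum_eq_zero_iff] at h0
    have := h0 j (by simp [hjk])
    omega
  obtain ⟨f, hf1, hfk, hfl, hfh, hf2⟩ : ∃ f, 1 ≤ f ∧ f ≤ ℓ k ∧ f + v ≤ β ∧ β ≤ f + O ∧
      (f ≠ 2 ∨ ℓ k = 2 ∨ v = 0) := by
    by_cases h1 : β ≤ 1 + O
    · exact ⟨1, by omega⟩
    by_cases h2 : β - O ≠ 2 ∨ ℓ k = 2 ∨ v = 0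
    · exact ⟨β - O, by omega, by omega, by omega, by omega, h2⟩
    -- All slots elsewhere would leave exactly two leaders for `k`. The other used machines have at
    -- least four slots each, so one of their leaders can be spared.
    · exact ⟨3, by omega⟩
  obtain ⟨ρ, h1, h2⟩ := exists_between_sum (Finset.univ.erase k) (fun j => min 1 (ℓ j)) ℓ
    (fun j _ => min_le_right _ _) (β - f) (by omega) (by omega)
  refine ⟨Function.update ρ k f, fun j => ?_, fun j hj => ?_, ?_, ?_⟩
  · by_cases hjk : j = k
    · subst hjk; simpa
    · rw [Function.update_of_ne hjk]
      exact (h1 j (by simp [hjk])).2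
  · by_cases hjk : j = k
    · subst hjk; simpa
    · rw [Function.update_of_ne hjk]
      have := (h1 j (by simp [hjk])).1
      omega
  · rw [Finset.sum_update_of_mem (Finset.mem_univ k), Finset.sdiff_singleton_eq_erase, h2]
    omega
  · rw [Function.update_self]
    rcases hf2 with h | h | h
    · exact Or.inl h
    · exact Or.inr (Or.inl h)
    · exact Or.inr (Or.inr (hsingle h))

/-- With a leader on every used machine no move leads to a block price or to a sole leader's
discount; only a free triple on the frontier machine has to be excluded. -/
lemma exists_isPNE_of_many_leaders [Nonempty (Fin m)] {S : Finset N}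
    {ℓ : Fin m → ℕ} (hℓ : ∑ j, ℓ j = S.card) {k : Fin m} (hk : pl.IsFrontier ℓ k)
    (hL : (Finset.univ.filter fun j => 0 < ℓ j).card ≤ (leaders grp S).card) :
    ∃ s : S → Fin m, IsPNE (pl.share b grp e) s := by
  obtain ⟨ρ, h1, h2, h3, h4⟩ := exists_leader_loads hk hL
    (hℓ ▸ Finset.card_le_card (Finset.filter_subset _ _))
  obtain ⟨g, -, hg, -⟩ := exists_monotone_assignment e (fun j : Fin m => (j : ℕ)) Finset.univ
    (leaders grp S) ρ h3
  replace hg : ∀ j, (usersOf g (leaders grp S) j).card = ρ j := fun j => hg j (Finset.mem_univ j)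
  obtain ⟨f, hf1, hf2, hf3⟩ := exists_assignment (grp := grp) e (fun j : Fin m => (j : ℕ)) ℓ hℓ
    g (fun j => by rw [hg]; exact h1 j)
  have hlead : ∀ j, (usersOf f S j).Nonempty → leaders grp (usersOf f S j) ≠ ∅ := fun j hj h => by
    have := h2 j ((usersOf_nonempty_iff hf1 j).1 hj)
    rw [← hg, ← hf2, h] at this
    exact lt_irrefl _ this
  refine ⟨fun i => f i, pl.share_le_of_balanced b grp e Fin.val_injective (fun i j hi _ => ?_) hf3
    (fun i _ _ j _ hne h0 _ => absurd h0 (hlead j hne)) (fun i hi hgi => Or.inr fun j hij =>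
    ⟨fun h0 hne => absurd h0 (hlead j hne), ?_⟩)⟩
  · rw [hf1, hf1]
    exact hk.idx_le i j ((usersOf_nonempty_iff hf1 i).1 hi)
  · rintro ⟨ht, hfull, h4'⟩
    rw [hf1] at hfull h4'
    obtain rfl := hk.eq_of_full_succ hfull
    have := ht.1
    rw [card_leaders_insert hgi (fun h => hij (mem_usersOf.1 h).2), hf2, hg] at this
    rcases h4 with h4 | h4 | h4
    · omega
    · omega
    · exact hij (h4 _ ((usersOf_nonempty_iff hf1 _).1 ⟨i, mem_usersOf.2 ⟨hi, rfl⟩⟩))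

/-- The last agent on the frontier machine is the first one in its block. -/
def IsStart (ℓ : Fin m → ℕ) (k : Fin m) : Prop := ℓ k = 1 ∨ pl.Full k (ℓ k - 1)

variable {pl} in
-- This keeps sole leaders in place. Joining a full machine lowers its level by one unless that
-- level is 0, so only the frontier machine inside its block needs an argument.
lemma level_succ_le_of_top {ℓ : Fin m → ℕ} {k : Fin m} (hk : pl.IsFrontier ℓ k) {Q : Finset (Fin m)}
    (hQ : ∀ q ∈ Q, 0 < ℓ q ∧ (pl.IsStart ℓ k → q ≠ k)) (hQb : Q.card ≤ b)
    (htop : ∀ q ∈ Q, ∀ j, 0 < ℓ j → (pl.IsStart ℓ k → j ≠ k) → j ∉ Q →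
      (2 * pl.level b j (ℓ j) + if j = k then 1 else 0) ≤
        2 * pl.level b q (ℓ q) + if q = k then 1 else 0)
    {q j : Fin m} (hq : q ∈ Q) (hj : 0 < ℓ j) (hjQ : j ∉ Q) :
    pl.level b j (ℓ j + 1) = 0 ∨ pl.level b j (ℓ j + 1) ≤ pl.level b q (ℓ q) := by
  have hqj : q ≠ j := fun h => hjQ (h ▸ hq)
  by_cases hfull : pl.Full j (ℓ j)
  · right
    have hjk : pl.IsStart ℓ k → j ≠ k := by
      rintro (h | h) rfl
      · exact absurd (hfull.four_le hj).1 (by omega)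
      · exact hfull.not_full_sub (by omega) (by omega) h
    have := htop q hq j hj hjk hjQ
    rw [pl.level_of_full b hfull hj] at this
    rw [pl.level_succ_of_full b hfull hj]
    split_ifs at this <;> omega
  · have hjk : j = k := by
      by_contra h
      exact hfull (hk.full h hj)
    subst hjk
    have hphase : pl.phase j (ℓ j + 1) = pl.phase j (ℓ j) := (not_not.1 hfull).symm
    have hqfull : pl.Full q (ℓ q) := hk.full hqj (hQ q hq).1
    have hlq := pl.level_of_full b hqfull (hQ q hq).1
    by_cases hs : pl.IsStart ℓ j
    · have hlev : pl.level b j (ℓ j + 1) = 2 * pl.tier b (pl.phase j (ℓ j)) := by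
        rw [level, if_neg (by omega), Nat.add_sub_cancel, if_neg hfull, if_pos, hphase]
        rcases hs with h | h
        · omega
        · exact Or.inr h
      rw [hlev]
      rcases Nat.eq_zero_or_pos (pl.tier b (pl.phase j (ℓ j))) with h0 | h0
      · omega
      right
      obtain ⟨ψ, hψ, ⟨_, hbig⟩, htier⟩ := pl.exists_big_of_tier_pos h0
      by_contra! hlt
      have hcap : ∀ i, pl.cap (ψ + 1) i ≤ ℓ i := by
        intro i
        by_contra! hc
        have h1 := pl.phase_le_iff.2 (Nat.succ_le_of_lt hc)
        have h2 := pl.phase_le_of_idx_le (hk.le_succ i)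
        simp only [Nat.succ_eq_add_one] at h1
        omega
      -- The machines that grew in the big phase `ψ`, apart from `j`, have a level above that of
      -- `q`, so all belong to `Q`. They number at least `b`, while `Q.erase q` has fewer than `b`
      -- elements.
      have hsub : (Finset.univ.filter fun i => pl.cap ψ i < pl.cap (ψ + 1) i).erase j ⊆ Q.erase q := by
        intro i hi
        obtain ⟨hij, hi⟩ := Finset.mem_erase.1 hi
        have hc := (Finset.mem_filter.1 hi).2
        have hi0 : 0 < ℓ i := by have := hcap i; omega
        have hph : ψ ≤ pl.phase i (ℓ i) := by
          by_contra! h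
          have h1 := (pl.phase_le_iff (φ := ψ - 1)).1 (show pl.phase i (ℓ i) ≤ ψ - 1 by omega)
          rw [show ψ - 1 + 1 = ψ by omega] at h1
          have := hcap i
          omega
        have hle : 2 * pl.tier b (pl.phase j (ℓ j)) ≤ pl.level b i (ℓ i) := by
          rw [htier, pl.level_of_full b (hk.full hij hi0) hi0]
          exact Nat.mul_le_mul_left 2 (pl.tier_mono b (Nat.succ_le_succ hph))
        refine Finset.mem_erase.2 ⟨fun h => ?_, ?_⟩
        · rw [h] at hle
          omega
        · by_contra hiQ
          have := htop q hq i hi0 (fun _ => hij) hiQ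
          rw [if_neg hij, if_neg hqj] at this
          omega
      have h1 := Finset.card_le_card hsub
      have h2 := Finset.pred_card_le_card_erase
        (s := Finset.univ.filter fun i => pl.cap ψ i < pl.cap (ψ + 1) i) (a := j)
      have h3 := Finset.card_erase_of_mem hq
      have := Finset.card_pos.2 ⟨q, hq⟩
      omega
    · right
      -- The tie-break in favour of the frontier machine makes the comparison of levels strict. Both
      -- are even, and `tier` grows by at most one per phase.
      have hkey := htop q hq j hj (fun h => absurd h hs) hjQ
      rw [if_pos rfl, if_neg hqj] at hkey
      unfold IsStart at hs
      push Not at hs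
      have hlev : pl.level b j (ℓ j + 1) = 2 * pl.tier b (pl.phase j (ℓ j) + 1) := by
        rw [level, if_neg (by omega), Nat.add_sub_cancel, if_neg hfull, if_neg, hphase]
        rintro (h | h)
        · omega
        · exact hs.2 h
      have hlev' : pl.level b j (ℓ j) = 2 * pl.tier b (pl.phase j (ℓ j)) ∨
          pl.level b j (ℓ j) = 2 * pl.tier b (pl.phase j (ℓ j) + 1) := by
        rw [level, if_neg (by omega), if_neg hs.2]
        split_ifs
        · exact Or.inl rfl
        · exact Or.inr rfl
      have ht := pl.tier_succ b (pl.phase j (ℓ j))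
      split_ifs at ht <;> omega

end Plan

namespace Plan

variable {m n₀ : ℕ} {c : Fin m → ℕ → ℝ≥0∞} (pl : Plan m c n₀)
variable {N : Type*} [DecidableEq N] (b : ℕ) (grp : N → ℕ) (e : N → ℕ)

/-- A set `Q` of machines for `w` agents that are the only leaders on their machines. -/
lemma exists_top_machines {ℓ : Fin m → ℕ} {k : Fin m} {w : ℕ}
    (hw : w < (Finset.univ.filter fun j => 0 < ℓ j).card) :
    ∃ Q : Finset (Fin m), Q.card = w ∧ (∀ q ∈ Q, 0 < ℓ q ∧ (pl.IsStart ℓ k → q ≠ k)) ∧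
      ∀ q ∈ Q, ∀ j, 0 < ℓ j → (pl.IsStart ℓ k → j ≠ k) → j ∉ Q →
        (2 * pl.level b j (ℓ j) + if j = k then 1 else 0) ≤
          2 * pl.level b q (ℓ q) + if q = k then 1 else 0 := by
  classical
  have hcard : w ≤ (Finset.univ.filter fun j => 0 < ℓ j ∧ (pl.IsStart ℓ k → j ≠ k)).card := by
    have h1 : (Finset.univ.filter fun j => 0 < ℓ j).erase k ⊆
        Finset.univ.filter fun j => 0 < ℓ j ∧ (pl.IsStart ℓ k → j ≠ k) := by
      intro j hj
      simp only [Finset.mem_erase, Finset.mem_filter, Finset.mem_univ, true_and] at hj ⊢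
      exact ⟨hj.2, fun _ => hj.1⟩
    have := Finset.card_le_card h1
    have := Finset.pred_card_le_card_erase (s := Finset.univ.filter fun j => 0 < ℓ j) (a := k)
    omega
  obtain ⟨Q, hQ, hQw, hmax⟩ := exists_top _
    (fun j => 2 * pl.level b j (ℓ j) + if j = k then 1 else 0) w hcard
  refine ⟨Q, hQw, fun q hq => by simpa using hQ hq, fun q hq j h1 h2 h3 => hmax q hq j ?_ h3⟩
  simpa using ⟨h1, h2⟩

/-- The remainder `W` of at most `3 * L` leaders sits alone on the machines `Q` of highest level;
all other leaders ride free in triples on full machines outside `Q`. -/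
lemma exists_isPNE_of_few_leaders [Nonempty (Fin m)] {S : Finset N} {L : ℕ}
    (hgrp : ∀ i ∈ S, grp i ≤ L) (hb : 3 * L ≤ b) (hne : (leaders grp S).Nonempty)
    {ℓ : Fin m → ℕ} (hℓ : ∑ j, ℓ j = S.card) {k : Fin m} (hk : pl.IsFrontier ℓ k)
    (hL : (leaders grp S).card < (Finset.univ.filter fun j => 0 < ℓ j).card) :
    ∃ s : S → Fin m, IsPNE (pl.share b grp e) s := by
  obtain ⟨W, hWA, hWne, hWcard, hWdiv⟩ := exists_remainder grp (L := L) (A := leaders grp S)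
    (fun i hi => ⟨Nat.pos_of_ne_zero (mem_leaders.1 hi).2, hgrp i (mem_leaders.1 hi).1⟩) hne
  have hWle := Finset.card_le_card hWA
  obtain ⟨Q, hQcard, hQ, htop⟩ := pl.exists_top_machines b (ℓ := ℓ) (k := k) (w := W.card)
    (by omega)
  obtain ⟨Z, hZ⟩ : ∃ Z, Z = ((Finset.univ.filter fun j => 0 < ℓ j).erase k) \ Q := ⟨_, rfl⟩
  have hmemZ : ∀ z ∈ Z, 0 < ℓ z ∧ z ≠ k ∧ z ∉ Q := by
    intro z hz
    simpa [hZ, and_assoc, and_left_comm] using hz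
  have hZcard : (leaders grp S \ W).card ≤ Z.card := by
    have h1 := Finset.le_card_sdiff Q ((Finset.univ.filter fun j => 0 < ℓ j).erase k)
    have h2 := Finset.pred_card_le_card_erase (s := Finset.univ.filter fun j => 0 < ℓ j) (a := k)
    rw [← hZ] at h1
    rw [Finset.card_sdiff_of_subset hWA]
    omega
  obtain ⟨h, hhZ, hh⟩ := exists_triples grp _ _ Z rfl hZcard hWdiv
  obtain ⟨g₀, hg₀Q, hg₀, -⟩ := exists_monotone_assignment e (fun j : Fin m => (j : ℕ)) Q W
    (fun _ => 1) (by simp [hQcard])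
  obtain ⟨g, hg⟩ : ∃ g : N → Fin m, g = fun i => if i ∈ W then g₀ i else h i := ⟨_, rfl⟩
  have hgW : ∀ i ∈ W, g i = g₀ i := fun i hi => by rw [hg]; exact if_pos hi
  have hgC : ∀ i ∉ W, g i = h i := fun i hi => by rw [hg]; exact if_neg hi
  have hfibQ : ∀ q ∈ Q, (usersOf g (leaders grp S) q).card = 1 := by
    intro q hq
    rw [← hg₀ q hq]
    congr 1
    ext i
    simp only [mem_usersOf, Finset.mem_filter]
    by_cases hi : i ∈ W
    · rw [hgW i hi]
      have := hWA hi
      tauto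
    · rw [hgC i hi]
      refine iff_of_false (fun h' => ?_) (fun h' => hi h'.1)
      exact (hmemZ _ (hhZ i (Finset.mem_sdiff.2 ⟨h'.1, hi⟩))).2.2 (h'.2 ▸ hq)
  have hfibC : ∀ i ∈ leaders grp S, i ∉ W → (usersOf g (leaders grp S) (g i)).card = 3 ∧
      ∀ a ∈ usersOf g (leaders grp S) (g i), grp a = grp i := by
    intro i hi hiW
    have hiC := Finset.mem_sdiff.2 ⟨hi, hiW⟩
    have hzQ := (hmemZ _ (hhZ i hiC)).2.2
    have he : usersOf g (leaders grp S) (g i) = (leaders grp S \ W).filter fun a => h a = h i := by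
      ext a
      rw [hgC i hiW]
      simp only [mem_usersOf, Finset.mem_filter, Finset.mem_sdiff]
      by_cases ha : a ∈ W
      · rw [hgW a ha]
        refine iff_of_false (fun h' => hzQ ?_) (fun h' => h'.1.2 ha)
        rw [← h'.2]
        exact hg₀Q a ha
      · rw [hgC a ha]
        tauto
    rw [he]
    refine ⟨(hh i hiC).1, fun a ha => (hh i hiC).2 a (Finset.mem_filter.1 ha).1
      (Finset.mem_filter.1 ha).2⟩
  have hfib : ∀ j, usersOf g (leaders grp S) j = ∅ ∨ (j ∈ Q ∧
      (usersOf g (leaders grp S) j).card = 1) ∨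
      ((usersOf g (leaders grp S) j).card = 3 ∧ pl.Full j (ℓ j) ∧ 4 ≤ ℓ j) := by
    intro j
    rcases (usersOf g (leaders grp S) j).eq_empty_or_nonempty with h0 | ⟨i, hi⟩
    · exact Or.inl h0
    right
    obtain ⟨hiS, rfl⟩ := mem_usersOf.1 hi
    by_cases hiW : i ∈ W
    · left
      have hq : g i ∈ Q := by rw [hgW i hiW]; exact hg₀Q i hiW
      exact ⟨hq, hfibQ _ hq⟩
    · right
      obtain ⟨hz0, hzk, -⟩ := hmemZ _ (hhZ i (Finset.mem_sdiff.2 ⟨hiS, hiW⟩))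
      have hf := hk.full hzk hz0
      refine ⟨(hfibC i hiS hiW).1, ?_⟩
      rw [hgC i hiW]
      exact ⟨hf, (hf.four_le hz0).1⟩
  obtain ⟨f, hf1, hf2, hf3⟩ := exists_assignment (grp := grp) e (fun j : Fin m => (j : ℕ)) ℓ hℓ
    g (fun j => by
      rcases hfib j with h0 | ⟨hq, h1⟩ | ⟨h3, -, h4⟩
      · simp [h0]
      · rw [h1]; exact (hQ j hq).1
      · omega)
  have hfg : ∀ i ∈ leaders grp S, f i = g i := by
    intro i hi
    have : i ∈ leaders grp (usersOf f S (f i)) :=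
      mem_leaders.2 ⟨mem_usersOf.2 ⟨(mem_leaders.1 hi).1, rfl⟩, (mem_leaders.1 hi).2⟩
    rw [hf2] at this
    exact (mem_usersOf.1 this).2.symm
  refine ⟨fun i => f i, pl.share_le_of_balanced b grp e Fin.val_injective (fun i j hi _ => ?_) hf3
    (fun i _ _ j _ _ h0 hfull => ?_) (fun i hi hgi => ?_)⟩
  · rw [hf1, hf1]
    exact hk.idx_le i j ((usersOf_nonempty_iff hf1 i).1 hi)
  -- A frontier machine one short of full counts its own phase, so its level is maximal; by the
  -- tie-break it belongs to the non-empty `Q` and has a leader.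
  · exfalso
    rw [hf1] at hfull
    obtain rfl := hk.eq_of_full_succ hfull
    have hj0 := hk.pos
    have hjQ : j ∉ Q := fun hq => by
      have := hfibQ j hq
      rw [← hf2, h0, Finset.card_empty] at this
      omega
    have h4 := (hfull.four_le (by omega)).1
    have hn1 : ¬ pl.Full j (ℓ j - 1) := hfull.not_full_sub (by omega) (by omega)
    have hn2 : ¬ pl.Full j (ℓ j - 2) := hfull.not_full_sub (by omega) (by omega)
    have hs : ¬ pl.IsStart ℓ j := by
      rintro (h | h)
      · omega
      · exact hn1 h
    obtain ⟨w, hw⟩ := hWne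
    have hq := hg₀Q w hw
    have hqj : g₀ w ≠ j := fun h => hjQ (h ▸ hq)
    have := htop _ hq j hj0 (fun h => absurd h hs) hjQ
    rw [if_pos rfl, if_neg hqj, level, if_neg (by omega), if_neg hn1, if_neg] at this
    · have h1 := pl.level_le b (g₀ w) (ℓ (g₀ w))
      have h2 := pl.tier_mono b (Nat.succ_le_succ (pl.phase_le_of_idx_le (hk.le _ (hQ _ hq).1)))
      simp only [Nat.succ_eq_add_one] at h2
      omega
    · rintro (h | h)
      · omega
      · exact hn2 h
  · have hiL := mem_leaders.2 ⟨hi, hgi⟩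
    by_cases hiW : i ∈ W
    · right
      have hq : f i ∈ Q := by rw [hfg i hiL, hgW i hiW]; exact hg₀Q i hiW
      intro j hij
      constructor
      · intro h0 hne
        have hj0 := (usersOf_nonempty_iff hf1 j).1 hne
        have hjQ : j ∉ Q := fun hj => by
          have := hfibQ j hj
          rw [← hf2, h0, Finset.card_empty] at this
          omega
        rw [share, if_pos hgi, if_pos (by rw [hf2]; exact hfibQ _ hq), hf1, hf1]
        rcases level_succ_le_of_top b hk hQ (by omega) htop hq hj0 hjQ with h | h
        · conv_rhs => rw [leaderPrice, if_pos h]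
          exact (pl.leaderPrice_le b _ _).trans
            (pl.toll_le_of_idx_le (hk.idx_le _ _ (hQ _ hq).1))
        · by_cases h' : pl.level b j (ℓ j + 1) = 0
          · conv_rhs => rw [leaderPrice, if_pos h']
            exact (pl.leaderPrice_le b _ _).trans
              (pl.toll_le_of_idx_le (hk.idx_le _ _ (hQ _ hq).1))
          · rw [leaderPrice, leaderPrice, if_neg (by omega), if_neg h']
            rcases h.lt_or_eq with h | h
            · exact (pl.levelPrice_lt_levelPrice h).le
            · rw [h]
      -- Machines carry 0, 1 or 3 leaders, so a newcomer never completes a triple.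
      · rintro ⟨ht, -, -⟩
        have h1 := ht.1
        rw [card_leaders_insert hgi (fun h => hij (mem_usersOf.1 h).2), hf2] at h1
        rcases hfib j with h | ⟨-, h⟩ | ⟨h, -⟩
        · rw [h, Finset.card_empty] at h1
          omega
        · omega
        · omega
    · left
      obtain ⟨h3, hsame⟩ := hfibC i hiL hiW
      rw [← hfg i hiL] at h3 hsame
      rw [share, if_pos hgi, hf2, h3, if_neg (by omega), if_pos]
      refine ⟨⟨by rw [hf2, h3], fun a ha a' ha' => ?_⟩, ?_⟩
      · rw [hf2] at ha ha'
        rw [hsame a ha, hsame a' ha']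
      · rw [hf1]
        rcases hfib (f i) with h | ⟨-, h⟩ | ⟨-, h, h'⟩
        · rw [h, Finset.card_empty] at h3
          omega
        · omega
        · exact ⟨h', h⟩

/-- The shares of a plan always admit a pure Nash equilibrium. -/
theorem exists_isPNE (hm : 0 < m) {L : ℕ} (hgrp : ∀ i, grp i ≤ L) (hb : 3 * L ≤ b)
    (S : Finset N) : ∃ s : S → Fin m, IsPNE (pl.share b grp e) s := by
  have : Nonempty (Fin m) := ⟨⟨0, hm⟩⟩
  rcases S.eq_empty_or_nonempty with rfl | hS
  · exact ⟨fun _ => ⟨0, hm⟩, fun i => absurd i.2 (Finset.notMem_empty _)⟩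
  obtain ⟨ℓ, hℓ, k, hk⟩ := pl.exists_frontier hS.card_pos
  rcases (leaders grp S).eq_empty_or_nonempty with hL | hL
  · by_cases hfull : pl.Full k (ℓ k + 1)
    · exact pl.exists_isPNE_of_full b grp e hL hℓ hk hfull
    · exact pl.exists_isPNE_of_not_full b grp e hL hℓ hk hfull
  · by_cases hcard : (Finset.univ.filter fun j => 0 < ℓ j).card ≤ (leaders grp S).card
    · exact pl.exists_isPNE_of_many_leaders b grp e hℓ hk hcard
    · exact pl.exists_isPNE_of_few_leaders b grp e (fun i _ => hgrp i) hb hL hℓ hk (by omega)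

end Plan

/-! ### The price of anarchy for a fixed set of agents -/

section

variable {N : Type*} {m : ℕ} {S : Finset N}

lemma mem_users {s : S → Fin m} {i : N} {j : Fin m} :
    i ∈ users s j ↔ ∃ h : i ∈ S, s ⟨i, h⟩ = j := by
  simp [users]

lemma sum_card_users (s : S → Fin m) : ∑ j, (users s j).card = S.card := by
  simp only [users, Finset.card_map]
  rw [← Fintype.card_coe S, ← Finset.card_univ]
  exact (Finset.card_eq_sum_card_fiberwise (fun _ _ => Finset.mem_coe.2 (Finset.mem_univ _))).symm

lemma notMem_users_of_ne {s : S → Fin m} {q j : Fin m} {i : N}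
    (hi : i ∈ users s q) (hj : q ≠ j) : i ∉ users s j := fun h' => by
  obtain ⟨h, h1⟩ := mem_users.1 hi
  exact hj (h1.symm.trans (mem_users.1 h').2)

variable [DecidableEq N]

lemma sum_card_leaders_users (grp : N → ℕ) (s : S → Fin m) :
    ∑ j, (leaders grp (users s j)).card = (leaders grp S).card := by
  rw [← Finset.card_biUnion]
  · congr 1
    ext i
    simp only [Finset.mem_biUnion, Finset.mem_univ, true_and, mem_leaders, mem_users]
    constructor
    · rintro ⟨j, ⟨h, -⟩, hg⟩
      exact ⟨h, hg⟩
    · rintro ⟨h, hg⟩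
      exact ⟨_, ⟨h, rfl⟩, hg⟩
  · intro j _ j' _ hjj'
    refine Finset.disjoint_left.2 fun i hi hi' => hjj' ?_
    obtain ⟨h, rfl⟩ := mem_users.1 (mem_leaders.1 hi).1
    obtain ⟨h', rfl⟩ := mem_users.1 (mem_leaders.1 hi').1
    rfl

lemma IsPNE.share_le {ξ : ShareRule N m} {s : S → Fin m} (hs : IsPNE ξ s) {q j : Fin m} {i : N}
    (hi : i ∈ users s q) (hj : q ≠ j) : ξ q (users s q) i ≤ ξ j (insert i (users s j)) i := by
  obtain ⟨h, rfl⟩ := mem_users.1 hi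
  have := hs ⟨i, h⟩ j
  rwa [agentShare, agentShare, Function.update_self, users_update] at this

lemma poa_le {c : Fin m → ℕ → ℝ≥0∞} {ξ : ShareRule N m} {K : ℝ≥0∞}
    (h : ∀ s : S → Fin m, IsPNE ξ s → ∀ t : S → Fin m, generatedCost c t ≠ ∞ →
      sufferedCost ξ s ≤ K * generatedCost c t) : poa c ξ S ≤ K := by
  unfold poa
  by_cases htop : (⨅ s : S → Fin m, generatedCost c s) = ∞
  · simp [htop]
  · have : Nonempty (S → Fin m) := by
      by_contra hne
      rw [not_nonempty_iff] at hne
      exact htop (iInf_of_empty _)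
    obtain ⟨t, ht⟩ := exists_eq_ciInf_of_finite (f := fun s : S → Fin m => generatedCost c s)
    rw [← ht] at htop ⊢
    exact ENNReal.div_le_of_le_mul (iSup₂_le fun s hs => h s hs t htop)

end

namespace Plan

variable {m n₀ : ℕ} {c : Fin m → ℕ → ℝ≥0∞} (pl : Plan m c n₀)
variable {N : Type*} {b : ℕ} {grp : N → ℕ} {e : N → ℕ}

variable {pl} in
-- At most two regular agents pay, since injectivity of `e` makes the first and the last unique.
lemma sum_regulars_le (he : Function.Injective e) {T : Finset N} {j : Fin m} {X : ℝ≥0∞}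
    (hX : ∀ i ∈ T, pl.share b grp e j T i ≤ X) :
    ∑ i ∈ regulars grp T, pl.share b grp e j T i ≤ 2 * X := by
  classical
  rcases (regulars grp T).eq_empty_or_nonempty with h0 | hne
  · simp [h0]
  obtain ⟨a, ha, hmin⟩ := Finset.exists_min_image _ e hne
  obtain ⟨z, hz, hmax⟩ := Finset.exists_max_image _ e hne
  have h0 : ∀ i ∈ regulars grp T, i ∉ ({a, z} : Finset N) → pl.share b grp e j T i = 0 := by
    intro i hi hiaz
    simp only [Finset.mem_insert, Finset.mem_singleton, not_or] at hiaz
    have hf : ¬ IsFirst grp e T i := fun h => hiaz.1 (he (le_antisymm (h a ha) (hmin i hi)))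
    have hl : ¬ IsLast grp e T i := fun h => hiaz.2 (he (le_antisymm (hmax i hi) (h z hz)))
    rw [share, if_neg (by simpa using (mem_regulars.1 hi).2)]
    simp [hf, hl]
  have hsub : ({a, z} : Finset N) ⊆ regulars grp T := by
    intro i hi
    rcases Finset.mem_insert.1 hi with rfl | hi
    · exact ha
    · rwa [Finset.mem_singleton.1 hi]
  rw [← Finset.sum_subset hsub h0]
  calc ∑ i ∈ ({a, z} : Finset N), pl.share b grp e j T i ≤ ∑ i ∈ ({a, z} : Finset N), X :=
        Finset.sum_le_sum fun i hi => hX i (mem_regulars.1 (hsub hi)).1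
    _ = ({a, z} : Finset N).card * X := by rw [Finset.sum_const, nsmul_eq_mul]
    _ ≤ 2 * X := by
      gcongr
      exact_mod_cast Finset.card_le_two

variable {pl} in
lemma sum_share_le (he : Function.Injective e) {T : Finset N} {j : Fin m} {X : ℝ≥0∞}
    (hX : ∀ i ∈ T, pl.share b grp e j T i ≤ X) :
    ∑ i ∈ T, pl.share b grp e j T i ≤ (leaders grp T).card * X + 2 * X := by
  have h1 : ∑ i ∈ T, pl.share b grp e j T i = ∑ i ∈ leaders grp T, pl.share b grp e j T i +
      ∑ i ∈ regulars grp T, pl.share b grp e j T i := by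
    rw [add_comm]
    exact (Finset.sum_filter_add_sum_filter_not _ _ _).symm
  rw [h1]
  gcongr
  · rw [← nsmul_eq_mul]
    exact Finset.sum_le_card_nsmul _ _ _ fun i hi => hX i (mem_leaders.1 hi).1
  · exact sum_regulars_le he hX

variable {pl} in
lemma sum_share_le_of_calm (he : Function.Injective e) {T : Finset N} {j : Fin m}
    (hL : leaders grp T = ∅) (hF : pl.Full j T.card) :
    ∑ i ∈ T, pl.share b grp e j T i ≤ pl.blockPrice b (pl.phase j T.card) j := by
  classical
  have hT : ∀ i ∈ T, i ∈ regulars grp T := by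
    intro i hi
    refine mem_regulars.2 ⟨hi, ?_⟩
    by_contra hg
    have : i ∈ leaders grp T := mem_leaders.2 ⟨hi, hg⟩
    simp [hL] at this
  rw [Finset.sum_congr rfl fun i hi =>
    pl.share_of_calm b grp e (mem_regulars.1 (hT i hi)).2 hL hF, ← Finset.sum_filter,
    Finset.sum_const, nsmul_eq_mul]
  have h1 : (T.filter fun i => IsFirst grp e T i).card ≤ 1 := by
    refine Finset.card_le_one.2 fun a ha z hz => ?_
    obtain ⟨ha, ha'⟩ := Finset.mem_filter.1 ha
    obtain ⟨hz, hz'⟩ := Finset.mem_filter.1 hz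
    exact he (le_antisymm (ha' z (hT z hz)) (hz' a (hT a ha)))
  calc _ ≤ ((1 : ℕ) : ℝ≥0∞) * _ := by gcongr
    _ = _ := by simp

lemma share_of_isFirst {T : Finset N} {i : N} {j : Fin m} (hg : grp i = 0)
    (hcalm : ¬ (leaders grp T = ∅ ∧ pl.Full j T.card)) (hf : IsFirst grp e T i) :
    pl.share b grp e j T i = pl.toll (pl.phase j T.card) j := by
  rw [share, if_neg (by simpa using hg), if_neg hcalm, if_pos (Or.inl hf)]

lemma phase_le_of_toll_lt {Φ φ : ℕ} {j : Fin m}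
    (h : pl.toll φ j < ENNReal.ofReal (2 * pl.base Φ)) : φ ≤ Φ := by
  by_contra! hc
  refine absurd h (not_lt.2 (le_trans ?_ (pl.base_le_toll φ j)))
  exact ENNReal.ofReal_le_ofReal ((pl.base_double Φ).trans (pl.base_mono hc))

variable [DecidableEq N] {S : Finset N} {s : S → Fin m} {Φ : ℕ}

variable {pl} in
-- Either some machine has room below `cap (Φ + 1)`, where nobody would pay more than a toll of
-- phase at most `Φ`, or all loads equal these caps.
lemma share_lt_of_isPNE (hs : IsPNE (pl.share b grp e) s) (hΦ : Φ < pl.last)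
    (hn : S.card ≤ ∑ j, pl.cap (Φ + 1) j) {j : Fin m} {i : N} (hi : i ∈ users s j) :
    pl.share b grp e j (users s j) i < ENNReal.ofReal (2 * pl.base Φ) := by
  have hlow : ∀ (j : Fin m) (T : Finset N), T.card ≤ pl.cap (Φ + 1) j →
      pl.share b grp e j T i < ENNReal.ofReal (2 * pl.base Φ) := by
    intro j T hT
    have hp := pl.phase_le_iff.2 hT
    refine (pl.share_le b grp e j T i).trans_lt ((pl.toll_lt (hp.trans hΦ.le) j).trans_le ?_)
    exact ENNReal.ofReal_le_ofReal (mul_le_mul_of_nonneg_left (pl.base_mono hp) zero_le_two)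
  by_cases hex : ∃ q, (users s q).card < pl.cap (Φ + 1) q
  · obtain ⟨q, hq⟩ := hex
    by_cases hjq : j = q
    · subst hjq
      exact hlow j _ hq.le
    · refine (hs.share_le hi hjq).trans_lt (hlow q _ ?_)
      rw [Finset.card_insert_of_notMem (notMem_users_of_ne hi hjq)]
      exact hq
  · push Not at hex
    refine hlow j _ ?_
    by_contra! hlt
    have := Finset.sum_lt_sum (fun q _ => hex q) ⟨j, Finset.mem_univ j, hlt⟩
    rw [sum_card_users] at this
    omega

variable {pl} in
lemma sufferedCost_le (hs : IsPNE (pl.share b grp e) s) (hΦ : Φ < pl.last)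
    (hn : S.card ≤ ∑ j, pl.cap (Φ + 1) j) :
    sufferedCost (pl.share b grp e) s ≤ S.card * ENNReal.ofReal (2 * pl.base Φ) := by
  calc sufferedCost (pl.share b grp e) s
      ≤ ∑ j, ((users s j).card : ℝ≥0∞) * ENNReal.ofReal (2 * pl.base Φ) := by
        refine Finset.sum_le_sum fun j _ => ?_
        rw [← nsmul_eq_mul]
        exact Finset.sum_le_card_nsmul _ _ _ fun i hi => (share_lt_of_isPNE hs hΦ hn hi).le
    _ = _ := by
        rw [← Finset.sum_mul, ← Nat.cast_sum, sum_card_users]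

variable {pl} in
/-- At most one machine without leaders is used but not full. -/
lemma eq_of_not_full (hs : IsPNE (pl.share b grp e) s) (hΦ : Φ < pl.last)
    (hn : S.card ≤ ∑ j, pl.cap (Φ + 1) j) {j q : Fin m} (hj : (users s j).Nonempty)
    (hq : (users s q).Nonempty) (hjL : leaders grp (users s j) = ∅)
    (hqL : leaders grp (users s q) = ∅) (hjF : ¬ pl.Full j (users s j).card)
    (hqF : ¬ pl.Full q (users s q).card) : j = q := by
  by_contra hjq
  wlog hlt : pl.idx j (users s j).card < pl.idx q (users s q).card generalizing j q
  · exact this hq hj hqL hjL hqF hjF (Ne.symm hjq)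
      (lt_of_le_of_ne (not_lt.1 hlt) fun h => hjq (pl.idx_injective h).symm)
  have hR : (regulars grp (users s q)).Nonempty := by
    rw [← Finset.card_pos]
    have := card_regulars_add_card_leaders grp (users s q)
    rw [hqL, Finset.card_empty] at this
    have := hq.card_pos
    omega
  -- The first regular agent on the later machine `q` would gain by joining the unfinished earlier
  -- block of `j`.
  obtain ⟨i, hi, hg, hf⟩ := exists_isFirst (e := e) hR
  have h1 := hs.share_le hi (Ne.symm hjq)
  have h2 := share_lt_of_isPNE hs hΦ hn hi
  rw [pl.share_of_isFirst hg (fun h => hqF h.2) hf] at h1 h2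
  have h3 := pl.phase_le_of_toll_lt h2
  refine absurd (h1.trans (pl.share_le b grp e j _ i)) (not_le.2 ?_)
  rw [Finset.card_insert_of_notMem (notMem_users_of_ne hi (Ne.symm hjq)), ← not_not.1 hjF]
  exact pl.toll_lt_of_idx_lt hlt (h3.trans hΦ.le)

variable {pl} in
/-- If some leader is the only agent of her group, no machine without leaders is full with a block
of a late phase. -/
lemma phase_le_of_full (hs : IsPNE (pl.share b grp e) s) (hΦ : Φ < pl.last)
    (hn : S.card ≤ ∑ j, pl.cap (Φ + 1) j) {a : N} (ha : a ∈ S) (hga : grp a ≠ 0)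
    (hlone : ∀ i ∈ S, grp i = grp a → i = a) {j : Fin m} (hj : (users s j).Nonempty)
    (hjL : leaders grp (users s j) = ∅) (hjF : pl.Full j (users s j).card) :
    pl.phase j (users s j).card ≤ Φ := by
  have hR : (regulars grp (users s j)).Nonempty := by
    rw [← Finset.card_pos]
    have := card_regulars_add_card_leaders grp (users s j)
    rw [hjL, Finset.card_empty] at this
    have := hj.card_pos
    omega
  obtain ⟨i, hi, hg, hf⟩ := exists_isFirst (e := e) hR
  have h2 := share_lt_of_isPNE hs hΦ hn hi
  rw [pl.share_of_calm b grp e hg hjL hjF, if_pos hf, blockPrice] at h2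
  split_ifs at h2 with hbig
  swap
  · exact pl.phase_le_of_toll_lt h2
  by_contra! hφ
  obtain ⟨q, haq⟩ : ∃ q, a ∈ users s q := ⟨_, mem_users.2 ⟨ha, rfl⟩⟩
  have haL : a ∈ leaders grp (users s q) := mem_leaders.2 ⟨haq, hga⟩
  have hqj : q ≠ j := by
    rintro rfl
    simp [hjL] at haL
  have hnot := notMem_users_of_ne haq hqj
  have htier := pl.tier_succ b (pl.phase j (users s j).card)
  rw [if_pos hbig] at htier
  have hlev := pl.level_succ_of_full b hjF hj.card_pos
  have hdev := hs.share_le haq hqj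
  conv_rhs at hdev => rw [share, if_pos hga, if_pos (by
    rw [card_leaders_insert hga hnot, hjL, Finset.card_empty]), leaderPrice,
    Finset.card_insert_of_notMem hnot, if_neg (by omega)]
  -- The lone leader is offered less than `base 0`. Unable to be in a triple, she can match this
  -- only as a sole leader at a positive level that is at least as high.
  have hlt := hdev.trans_lt (pl.levelPrice_lt (g := pl.level b j ((users s j).card + 1)) (by omega))
  rw [share, if_pos hga] at hdev hlt
  have htriple : ¬ IsTriple grp (users s q) := by
    rintro ⟨h3, hsame⟩
    have : (leaders grp (users s q)).card ≤ 1 := by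
      refine Finset.card_le_one.2 fun x hx y hy => ?_
      have hxy : ∀ z ∈ leaders grp (users s q), z = a := fun z hz =>
        hlone z (mem_users.1 (mem_leaders.1 hz).1).1 (hsame z hz a haL)
      rw [hxy x hx, hxy y hy]
    omega
  rw [if_neg (c := IsTriple grp (users s q) ∧ _) (fun h => htriple h.1)] at hdev hlt
  split_ifs at hdev hlt with h1
  swap
  · exact absurd hlt (not_lt.2 (pl.ofReal_base_zero_le_toll _ _))
  unfold leaderPrice at hdev hlt
  split_ifs at hdev hlt with h0
  · exact absurd hlt (not_lt.2 (pl.ofReal_base_zero_le_toll _ _))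
  have hge : pl.level b j ((users s j).card + 1) ≤ pl.level b q (users s q).card := by
    by_contra! h
    exact absurd hdev (not_le.2 (pl.levelPrice_lt_levelPrice h))
  -- A positive level means that a regular agent shares her machine. The first one pays its toll, so
  -- its phase is at most `Φ`, where the level is too low.
  have hq2 : 2 ≤ (users s q).card := by
    by_contra! h
    exact h0 (by rw [level, if_pos (by omega)])
  have hRq : (regulars grp (users s q)).Nonempty := by
    rw [← Finset.card_pos]
    have := card_regulars_add_card_leaders grp (users s q)
    omega
  obtain ⟨r, hr, hgr, hfr⟩ := exists_isFirst (e := e) hRq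
  have h3 := share_lt_of_isPNE hs hΦ hn hr
  rw [pl.share_of_isFirst hgr (fun h => by simp [h.1] at haL) hfr] at h3
  have h4 := pl.phase_le_of_toll_lt h3
  have h5 := pl.level_le b q (users s q).card
  have h6 := pl.tier_mono b (show pl.phase q (users s q).card + 1 ≤ pl.phase j (users s j).card by
    omega)
  omega

end Plan

namespace Plan

variable {m n₀ : ℕ} {c : Fin m → ℕ → ℝ≥0∞} (pl : Plan m c n₀)
variable {N : Type*} {b : ℕ} {grp : N → ℕ} {e : N → ℕ}

lemma sum_base_le (Φ : ℕ) : ∑ φ ∈ Finset.range (Φ + 1), pl.base φ ≤ 2 * pl.base Φ := by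
  induction Φ with
  | zero => simpa using by linarith [pl.base_pos]
  | succ Φ ih =>
    rw [Finset.sum_range_succ]
    linarith [pl.base_double Φ]

open Classical in
-- At most `b` machines grow in a phase that is not big, and the bases sum geometrically.
lemma sum_small_le {Φ : ℕ} (hΦ : Φ < pl.last) :
    ∑ j, ∑ φ ∈ Finset.range (Φ + 1), (if ¬ pl.Big b φ ∧ pl.cap φ j < pl.cap (φ + 1) j then
      ENNReal.ofReal (2 * pl.base φ) else 0) ≤ 2 * b * ENNReal.ofReal (2 * pl.base Φ) := by
  rw [Finset.sum_comm]
  calc _ ≤ ∑ φ ∈ Finset.range (Φ + 1), (b : ℝ≥0∞) * ENNReal.ofReal (2 * pl.base φ) := by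
        refine Finset.sum_le_sum fun φ hφ => ?_
        by_cases hb : pl.Big b φ
        · simp [hb]
        · simp only [hb, not_false_eq_true, true_and]
          rw [← Finset.sum_filter, Finset.sum_const, nsmul_eq_mul]
          have : (Finset.univ.filter fun j => pl.cap φ j < pl.cap (φ + 1) j).card ≤ b := by
            by_contra! h
            exact hb ⟨by have := Finset.mem_range.1 hφ; omega, h⟩
          gcongr
    _ = b * ENNReal.ofReal (∑ φ ∈ Finset.range (Φ + 1), 2 * pl.base φ) := by
        rw [← Finset.mul_sum, ENNReal.ofReal_sum_of_nonneg]
        exact fun φ _ => by linarith [pl.base_pos' φ]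
    _ ≤ b * ENNReal.ofReal (2 * (2 * pl.base Φ)) := by
        rw [← Finset.mul_sum]
        gcongr
        exact pl.sum_base_le Φ
    _ = _ := by
        rw [ENNReal.ofReal_mul zero_le_two, ENNReal.ofReal_ofNat]
        ring

variable [DecidableEq N] {S : Finset N} {s : S → Fin m} {Φ : ℕ}

variable {pl} in
-- Full leaderless machines pay their true cost, bounded by the cost of `cap (Φ + 1)`, or a toll of
-- a small phase. At most one used leaderless machine is not full. A machine with `r ≥ 1` leaders
-- has at most `r + 2 ≤ 3 * r` payers.
lemma sufferedCost_le_of_lone (hc : ∀ j, Monotone (c j)) (he : Function.Injective e)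
    (hs : IsPNE (pl.share b grp e) s) (hΦ : Φ < pl.last)
    (hn : S.card ≤ ∑ j, pl.cap (Φ + 1) j) {a : N} (ha : a ∈ S) (hga : grp a ≠ 0)
    (hlone : ∀ i ∈ S, grp i = grp a → i = a) :
    sufferedCost (pl.share b grp e) s ≤
      (3 * (leaders grp S).card + 2 * b + 3 : ℕ) * ENNReal.ofReal (2 * pl.base Φ) := by
  classical
  obtain ⟨X, hX⟩ : ∃ X, X = ENNReal.ofReal (2 * pl.base Φ) := ⟨_, rfl⟩
  have hlt : ∀ j, ∀ i ∈ users s j, pl.share b grp e j (users s j) i ≤ X := fun j i hi => by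
    rw [hX]
    exact (share_lt_of_isPNE hs hΦ hn hi).le
  let P : Fin m → Prop := fun j => (users s j).Nonempty ∧ leaders grp (users s j) = ∅ ∧
    ¬ pl.Full j (users s j).card
  let R : Fin m → ℝ≥0∞ := fun j => ∑ φ ∈ Finset.range (Φ + 1),
    (if ¬ pl.Big b φ ∧ pl.cap φ j < pl.cap (φ + 1) j then ENNReal.ofReal (2 * pl.base φ) else 0)
  have hmachine : ∀ j, ∑ i ∈ users s j, pl.share b grp e j (users s j) i ≤
      3 * (leaders grp (users s j)).card * X + (if P j then 2 * X else 0) +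
        c j (pl.cap (Φ + 1) j) + R j := by
    intro j
    rcases (users s j).eq_empty_or_nonempty with h0 | hne
    · refine le_trans (le_of_eq ?_) zero_le
      rw [h0, Finset.sum_empty]
    by_cases hL : leaders grp (users s j) = ∅
    · by_cases hF : pl.Full j (users s j).card
      · have hp := phase_le_of_full hs hΦ hn ha hga hlone hne hL hF
        refine (sum_share_le_of_calm he hL hF).trans ?_
        by_cases hbig : pl.Big b (pl.phase j (users s j).card)
        · rw [blockPrice, if_pos hbig]
          refine le_trans ?_ (self_le_add_right _ _)
          refine le_trans ?_ (self_le_add_left _ _)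
          exact hc j (pl.cap_mono j (Nat.succ_le_succ hp))
        · rw [blockPrice, if_neg hbig]
          refine le_trans ?_ (self_le_add_left _ _)
          refine le_trans ?_ (Finset.single_le_sum (fun _ _ => zero_le)
            (Finset.mem_range.2 (Nat.lt_succ_of_le hp)))
          rw [if_pos ⟨hbig, (pl.cap_phase_lt hne.card_pos).trans_le (pl.le_cap_phase j _)⟩]
          exact (pl.toll_lt (hp.trans hΦ.le) j).le
      · have hP : P j := ⟨hne, hL, hF⟩
        rw [if_pos hP]
        refine (sum_share_le he (hlt j)).trans ?_
        rw [hL, Finset.card_empty]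
        simp only [Nat.cast_zero, mul_zero, zero_mul, zero_add]
        rw [add_assoc]
        exact self_le_add_right _ _
    · refine (sum_share_le he (hlt j)).trans ?_
      have h1 : 1 ≤ (leaders grp (users s j)).card :=
        Finset.card_pos.2 (Finset.nonempty_iff_ne_empty.2 hL)
      rw [add_assoc, add_assoc]
      refine le_trans ?_ (self_le_add_right _ _)
      rw [← add_mul]
      gcongr
      exact_mod_cast (by omega : (leaders grp (users s j)).card + 2 ≤
        3 * (leaders grp (users s j)).card)
  have h1 : ∑ j, 3 * ((leaders grp (users s j)).card : ℝ≥0∞) * X =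
      3 * (leaders grp S).card * X := by
    rw [← Finset.sum_mul, ← Finset.mul_sum, ← sum_card_leaders_users grp s, Nat.cast_sum]
  have h2 : ∑ j, (if P j then 2 * X else 0) ≤ 2 * X := by
    rw [← Finset.sum_filter, Finset.sum_const, nsmul_eq_mul]
    have : (Finset.univ.filter P).card ≤ 1 := Finset.card_le_one.2 fun j hj q hq => by
      have hj := (Finset.mem_filter.1 hj).2
      have hq := (Finset.mem_filter.1 hq).2
      exact eq_of_not_full hs hΦ hn hj.1 hq.1 hj.2.1 hq.2.1 hj.2.2 hq.2.2
    calc _ ≤ ((1 : ℕ) : ℝ≥0∞) * (2 * X) := by gcongr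
      _ = _ := by simp
  have h3 : ∑ j, c j (pl.cap (Φ + 1) j) ≤ X := by
    rw [hX]
    refine (pl.cost_le Φ hΦ.le).trans (ENNReal.ofReal_le_ofReal ?_)
    linarith [pl.base_pos' Φ]
  have h4 : ∑ j, R j ≤ 2 * b * X := by
    rw [hX]
    exact pl.sum_small_le hΦ
  calc sufferedCost (pl.share b grp e) s
      ≤ ∑ j, (3 * (leaders grp (users s j)).card * X + (if P j then 2 * X else 0) +
        c j (pl.cap (Φ + 1) j) + R j) := Finset.sum_le_sum fun j _ => hmachine j
    _ ≤ 3 * (leaders grp S).card * X + 2 * X + X + 2 * b * X := by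
      rw [Finset.sum_add_distrib, Finset.sum_add_distrib, Finset.sum_add_distrib, h1]
      gcongr
    _ = _ := by
      rw [← hX]
      push_cast
      ring

omit [DecidableEq N] in
lemma exists_phase {t : S → Fin m} (hS : S.Nonempty) (hn₀ : S.card ≤ n₀)
    (ht : generatedCost c t ≠ ∞) : ∃ Φ < pl.last, S.card ≤ ∑ j, pl.cap (Φ + 1) j ∧
      ENNReal.ofReal (2 * pl.base Φ) ≤ 8 * generatedCost c t := by
  obtain ⟨Φ, h1, h2, h3⟩ := pl.opt (fun j => (users t j).card)
    (by rw [sum_card_users]; exact hS.card_pos) (by rwa [sum_card_users]) ht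
  rw [sum_card_users] at h2
  refine ⟨Φ, h1, h2, ?_⟩
  rw [ENNReal.ofReal_mul zero_le_two, ENNReal.ofReal_ofNat]
  calc _ ≤ 2 * (4 * generatedCost c t) := by gcongr; exact h3
    _ = _ := by ring

theorem poa_share_le (hn₀ : S.card ≤ n₀) :
    poa c (pl.share b grp e) S ≤ (8 * S.card : ℕ) := by
  refine poa_le fun s hs t ht => ?_
  rcases S.eq_empty_or_nonempty with rfl | hS
  · simp [sufferedCost, users]
  obtain ⟨Φ, h1, h2, h3⟩ := pl.exists_phase hS hn₀ ht
  calc _ ≤ _ := sufferedCost_le hs h1 h2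
    _ ≤ S.card * (8 * generatedCost c t) := by gcongr
    _ = _ := by push_cast; ring

theorem poa_share_le_of_lone (hn₀ : S.card ≤ n₀) (hc : ∀ j, Monotone (c j))
    (he : Function.Injective e) {a : N} (ha : a ∈ S) (hga : grp a ≠ 0)
    (hlone : ∀ i ∈ S, grp i = grp a → i = a) :
    poa c (pl.share b grp e) S ≤ (8 * (3 * (leaders grp S).card + 2 * b + 3) : ℕ) := by
  refine poa_le fun s hs t ht => ?_
  obtain ⟨Φ, h1, h2, h3⟩ := pl.exists_phase ⟨a, ha⟩ hn₀ ht
  calc _ ≤ _ := sufferedCost_le_of_lone hc he hs h1 h2 ha hga hlone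
    _ ≤ (3 * (leaders grp S).card + 2 * b + 3 : ℕ) * (8 * generatedCost c t) := by gcongr
    _ = _ := by push_cast; ring

end Plan

/-! ### Construction of a plan -/

/-- The end of the step of a 4-step cost function that contains a given load. -/
lemma IsFourStepCost.exists_stepEnd {c : ℕ → ℝ≥0∞} (h : IsFourStepCost c) :
    ∃ r : ℕ → ℕ, r 0 = 0 ∧ (∀ x, x ≤ r x) ∧ (∀ x, c (r x) = c x) ∧
      ∀ x y, x ≤ y → r y = r x ∨ r x + 4 ≤ r y := by
  obtain ⟨len, h4, hstep⟩ := h.step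
  have hsucc : ∀ k, ∑ i ∈ Finset.range (k + 1), len i = ∑ i ∈ Finset.range k, len i + len k :=
    fun k => Finset.sum_range_succ _ _
  have hmono : Monotone fun k => ∑ i ∈ Finset.range k, len i :=
    monotone_nat_of_le_succ fun k => by rw [hsucc]; omega
  have hge : ∀ k, k ≤ ∑ i ∈ Finset.range k, len i := by
    intro k
    induction k with
    | zero => simp
    | succ k ih => rw [hsucc]; have := h4 k; omega
  have hex : ∀ x, ∃ k, x ≤ ∑ i ∈ Finset.range k, len i := fun x => ⟨x, hge x⟩
  have hmin : ∀ x k, x ≤ ∑ i ∈ Finset.range k, len i → Nat.find (hex x) ≤ k :=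
    fun x k hk => Nat.find_min' (hex x) hk
  refine ⟨fun x => ∑ i ∈ Finset.range (Nat.find (hex x)), len i, ?_,
    fun x => Nat.find_spec (hex x), fun x => ?_, fun x y hxy => ?_⟩
  · have h0 : Nat.find (hex 0) = 0 := Nat.le_zero.1 (hmin 0 0 (by simp))
    simp only [h0, Finset.range_zero, Finset.sum_empty]
  · have hs := Nat.find_spec (hex x)
    dsimp only
    rcases hk : Nat.find (hex x) with _ | k
    · rw [hk, Finset.range_zero, Finset.sum_empty, Nat.le_zero] at hs
      simp [hs]
    · have hlt : ∑ i ∈ Finset.range k, len i < x := by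
        by_contra! hc
        have := hmin x k hc
        omega
      rw [hk] at hs
      exact (hstep k x hlt hs).symm
  · have hle : Nat.find (hex x) ≤ Nat.find (hex y) :=
      hmin x _ (hxy.trans (Nat.find_spec (hex y)))
    rcases hle.eq_or_lt with he | hlt
    · left
      simp only [he]
    · right
      have h1 := hmono (Nat.succ_le_of_lt hlt)
      have h2 := h4 (Nat.find (hex x))
      simp only [Nat.succ_eq_add_one, hsucc] at h1
      dsimp only
      omega

lemma exists_pos_le_of_finite {m : ℕ} (f : Fin m → ℝ≥0∞) (hf : ∀ j, 0 < f j) :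
    ∃ a : ℝ, 0 < a ∧ ∀ j, ENNReal.ofReal a ≤ f j := by
  have h0 : 0 < (Finset.univ.inf f) ⊓ 1 := by
    rw [lt_inf_iff, Finset.lt_inf_iff (by simp)]
    exact ⟨fun j _ => hf j, one_pos⟩
  have htop : (Finset.univ.inf f) ⊓ 1 ≠ ∞ := ne_top_of_le_ne_top ENNReal.one_ne_top inf_le_right
  refine ⟨((Finset.univ.inf f) ⊓ 1).toReal, ENNReal.toReal_pos h0.ne' htop, fun j => ?_⟩
  rw [ENNReal.ofReal_toReal htop]
  exact inf_le_left.trans (Finset.inf_le (Finset.mem_univ j))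

lemma exists_maximal_of_bounded {α : Type*} (p : α → Prop) (f : α → ℕ) (B : ℕ) (h : ∃ x, p x)
    (hB : ∀ x, p x → f x ≤ B) : ∃ x, p x ∧ ∀ y, p y → f y ≤ f x := by
  have hbdd : BddAbove (f '' {x | p x}) := ⟨B, by rintro _ ⟨x, hx, rfl⟩; exact hB x hx⟩
  obtain ⟨x, hx, hfx⟩ := Nat.sSup_mem (Set.Nonempty.image f h) hbdd
  exact ⟨x, hx, fun y hy => hfx ▸ le_csSup hbdd ⟨y, hy, rfl⟩⟩

/-- For 4-step cost functions there is a plan, for any number of agents. -/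
theorem exists_plan {m : ℕ} {c : Fin m → ℕ → ℝ≥0∞} (hc : ∀ j, IsFourStepCost (c j)) (n₀ : ℕ) :
    Nonempty (Plan m c n₀) := by
  choose r hr0 hrle hrc hr4 using fun j => (hc j).exists_stepEnd
  obtain ⟨a, ha, hac⟩ := exists_pos_le_of_finite (fun j => c j 1) fun j => (hc j).pos 1 one_pos
  obtain ⟨M, hM⟩ : ∃ M : ℝ, M = ∑ j, ∑ ℓ ∈ Finset.range (n₀ + 1), (c j ℓ).toReal := ⟨_, rfl⟩
  obtain ⟨F, hF⟩ := pow_unbounded_of_one_lt (M / a) one_lt_two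
  rw [div_lt_iff₀ ha] at hF
  have hcostM : ∀ x : Fin m → ℕ, ∑ j, x j ≤ n₀ → ∑ j, c j (x j) ≠ ∞ →
      ∑ j, c j (x j) ≤ ENNReal.ofReal (2 ^ F * a) := by
    intro x hx hfin
    rw [← ENNReal.ofReal_toReal hfin]
    apply ENNReal.ofReal_le_ofReal
    refine le_trans ?_ hF.le
    rw [hM, ENNReal.toReal_sum fun j _ => (ENNReal.sum_ne_top.1 hfin) j (Finset.mem_univ j)]
    refine Finset.sum_le_sum fun j _ => ?_
    refine Finset.single_le_sum (f := fun ℓ => (c j ℓ).toReal)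
      (fun _ _ => ENNReal.toReal_nonneg) (Finset.mem_range.2 ?_)
    have := Finset.single_le_sum (f := x) (fun _ _ => Nat.zero_le _) (Finset.mem_univ j)
    omega
  -- `y φ` serves as many agents as possible within the budget `2 ^ φ * a`.
  have hy : ∀ φ : ℕ, ∃ y : Fin m → ℕ, (∑ j, y j ≤ n₀ ∧
      ∑ j, c j (y j) ≤ ENNReal.ofReal (2 ^ φ * a)) ∧ ∀ x : Fin m → ℕ, (∑ j, x j ≤ n₀ ∧
      ∑ j, c j (x j) ≤ ENNReal.ofReal (2 ^ φ * a)) → ∑ j, x j ≤ ∑ j, y j := fun φ =>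
    exists_maximal_of_bounded _ (fun x : Fin m → ℕ => ∑ j, x j) n₀
      ⟨fun _ => 0, by simp, by simp [(hc _).zero]⟩ fun x hx => hx.1
  choose y hy1 hy2 using hy
  have hz : ∀ j, ∃ z, (z ≤ n₀ ∧ c j z ≠ ∞) ∧ ∀ ℓ, (ℓ ≤ n₀ ∧ c j ℓ ≠ ∞) → ℓ ≤ z := fun j =>
    exists_maximal_of_bounded (fun z => z ≤ n₀ ∧ c j z ≠ ∞) id n₀ ⟨0, by simp [(hc j).zero]⟩
      fun x hx => hx.1
  choose z hz1 hz2 using hz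
  -- After the budgeted phases, one phase reaches all finite loads up to `n₀`; later ones only make
  -- the caps unbounded. Running maxima `w`, rounded up to ends of steps at no cost, become the
  -- caps.
  obtain ⟨u, hu⟩ : ∃ u : ℕ → Fin m → ℕ, u = fun φ j =>
    if φ ≤ F then y φ j else if φ = F + 1 then z j else φ := ⟨_, rfl⟩
  obtain ⟨w, hw⟩ : ∃ w : ℕ → Fin m → ℕ, w = fun φ j => (Finset.range φ).sup fun ψ => u ψ j :=
    ⟨_, rfl⟩
  have hwu : ∀ φ j, u φ j ≤ w (φ + 1) j := fun φ j => by
    rw [hw]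
    exact Finset.le_sup (f := fun ψ => u ψ j) (Finset.self_mem_range_succ φ)
  have hwmono : ∀ φ j, w φ j ≤ w (φ + 1) j := fun φ j => by
    rw [hw]
    exact Finset.sup_mono (Finset.range_mono (Nat.le_succ φ))
  have hcw : ∀ φ j, c j (w φ j) ≤ ∑ ψ ∈ Finset.range φ, c j (u ψ j) := by
    intro φ j
    rcases (Finset.range φ).eq_empty_or_nonempty with h0 | hne
    · rw [hw]
      simp [h0, (hc j).zero]
    · obtain ⟨ψ, hψ, he⟩ := Finset.exists_mem_eq_sup _ hne fun ψ => u ψ j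
      rw [hw]
      dsimp only
      rw [he]
      exact Finset.single_le_sum (f := fun ψ => c j (u ψ j)) (fun _ _ => zero_le) hψ
  have hyfin : ∀ φ j, c j (y φ j) ≠ ∞ := fun φ j =>
    ENNReal.sum_ne_top.1 (ne_top_of_le_ne_top ENNReal.ofReal_ne_top (hy1 φ).2) j
      (Finset.mem_univ j)
  have hBfin : ∑ j, c j (w (F + 2) j) ≠ ∞ := by
    refine ENNReal.sum_ne_top.2 fun j _ => ne_top_of_le_ne_top ?_ (hcw _ j)
    refine ENNReal.sum_ne_top.2 fun ψ hψ => ?_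
    have := Finset.mem_range.1 hψ
    rw [hu]
    dsimp only
    split_ifs
    · exact hyfin ψ j
    · exact (hz1 j).2
    · omega
  obtain ⟨B, hB⟩ : ∃ B, B = (∑ j, c j (w (F + 2) j)).toReal := ⟨_, rfl⟩
  have hB0 : 0 ≤ B := hB ▸ ENNReal.toReal_nonneg
  have hcap : ∀ φ, ∑ j, c j (r j (w φ j)) = ∑ j, c j (w φ j) := fun φ =>
    Finset.sum_congr rfl fun j _ => hrc j _
  refine ⟨{
    cap := fun φ j => r j (w φ j)
    last := F + 1
    -- A running maximum costs at most the sum of the earlier budgets, which is below `2 ^ φ * (2 *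
    -- a)`; `B` covers the last phase of finite cost.
    base := fun φ => if φ ≤ F then 2 ^ φ * (2 * a) else 2 ^ φ * (2 * a + B)
    cap_zero := fun j => by simp [hw, hr0]
    cap_succ := fun φ j => hr4 j _ _ (hwmono φ j)
    cap_unbounded := fun j ℓ => ⟨ℓ + F + 2, ?_⟩
    base_pos := by simpa using ha
    base_double := fun φ => ?_
    cost_le := fun φ hφ => ?_
    finite_le := fun j ℓ hℓ hfin => ?_
    opt := fun x hx0 hx hfin => ?_ }⟩
  · refine le_trans ?_ (hrle j _)
    refine le_trans ?_ (hwu _ j)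
    rw [hu]
    dsimp only
    rw [if_neg (by omega), if_neg (by omega)]
    omega
  · have h2 : (0 : ℝ) < 2 ^ φ := by positivity
    have h3 : 0 ≤ 2 ^ φ * B := by positivity
    rw [pow_succ]
    split_ifs
    · linarith
    · linarith
    · omega
    · linarith
  · rw [hcap]
    split_ifs with hφF
    · calc ∑ j, c j (w (φ + 1) j) ≤ ∑ j, ∑ ψ ∈ Finset.range (φ + 1), c j (y ψ j) := by
            refine Finset.sum_le_sum fun j _ => (hcw _ j).trans (le_of_eq ?_)
            refine Finset.sum_congr rfl fun ψ hψ => ?_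
            have := Finset.mem_range.1 hψ
            rw [hu]
            dsimp only
            rw [if_pos (by omega)]
        _ = ∑ ψ ∈ Finset.range (φ + 1), ∑ j, c j (y ψ j) := Finset.sum_comm
        _ ≤ ∑ ψ ∈ Finset.range (φ + 1), ENNReal.ofReal (2 ^ ψ * a) :=
            Finset.sum_le_sum fun ψ _ => (hy1 ψ).2
        _ = ENNReal.ofReal (∑ ψ ∈ Finset.range (φ + 1), 2 ^ ψ * a) :=
            (ENNReal.ofReal_sum_of_nonneg fun ψ _ => by positivity).symm
        _ ≤ _ := by
            apply ENNReal.ofReal_le_ofReal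
            rw [← Finset.sum_mul, geom_sum_eq (by norm_num)]
            have : (0 : ℝ) < 2 ^ φ := by positivity
            rw [pow_succ]
            nlinarith
    · obtain rfl : φ = F + 1 := by omega
      rw [← ENNReal.ofReal_toReal hBfin, ← hB]
      apply ENNReal.ofReal_le_ofReal
      have : (1 : ℝ) ≤ 2 ^ (F + 1) := one_le_pow₀ one_le_two
      nlinarith
  · refine le_trans ?_ (hrle j _)
    refine le_trans ?_ (hwu _ j)
    rw [hu]
    dsimp only
    rw [if_neg (by omega), if_pos rfl]
    exact hz2 j ℓ ⟨hℓ, hfin⟩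
  · obtain ⟨j, hj⟩ : ∃ j, 1 ≤ x j := by
      by_contra! h
      have : ∑ j, x j = 0 := Finset.sum_eq_zero fun j _ => by have := h j; omega
      omega
    have hlow : ENNReal.ofReal a ≤ ∑ j, c j (x j) :=
      (hac j).trans (((hc j).mono hj).trans (Finset.single_le_sum (f := fun j => c j (x j))
        (fun _ _ => zero_le) (Finset.mem_univ j)))
    have hex : ∃ φ : ℕ, ∑ j, c j (x j) ≤ ENNReal.ofReal (2 ^ φ * a) := ⟨F, hcostM x hx hfin⟩
    have hφF : Nat.find hex ≤ F := Nat.find_min' hex (hcostM x hx hfin)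
    refine ⟨Nat.find hex, by omega, ?_, ?_⟩
    · refine (hy2 _ x ⟨hx, Nat.find_spec hex⟩).trans (Finset.sum_le_sum fun j _ => ?_)
      refine le_trans ?_ (hrle j _)
      refine le_trans (le_of_eq ?_) (hwu _ j)
      rw [hu]
      dsimp only
      rw [if_pos hφF]
    · rw [if_pos hφF]
      rcases hφ : Nat.find hex with _ | φ
      · calc ENNReal.ofReal (2 ^ 0 * (2 * a)) = 2 * ENNReal.ofReal a := by
              rw [pow_zero, one_mul, ENNReal.ofReal_mul zero_le_two, ENNReal.ofReal_ofNat]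
          _ ≤ 4 * ∑ j, c j (x j) := by
            gcongr
            norm_num
      · have hlt := not_le.1 (Nat.find_min hex (m := φ) (by omega))
        calc ENNReal.ofReal (2 ^ (φ + 1) * (2 * a)) = 4 * ENNReal.ofReal (2 ^ φ * a) := by
              rw [show (2 : ℝ) ^ (φ + 1) * (2 * a) = 4 * (2 ^ φ * a) by ring,
                ENNReal.ofReal_mul zero_le_four, ENNReal.ofReal_ofNat]
          _ ≤ _ := by gcongr

/-! ### Independent arrivals and the choice of groups -/

section Expectation

variable {N : Type*} [DecidableEq N] (p : N → ℝ)

/-- The expectation of `F T`, where the agents of `A` belong to `T` independently with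
probabilities `p`. -/
noncomputable def expect (A : Finset N) (F : Finset N → ℝ) : ℝ :=
  ∑ T ∈ A.powerset, ((∏ i ∈ T, p i) * ∏ i ∈ A \ T, (1 - p i)) * F T

variable {p} in
lemma expect_congr {A : Finset N} {F G : Finset N → ℝ} (h : ∀ T ⊆ A, F T = G T) :
    expect p A F = expect p A G :=
  Finset.sum_congr rfl fun T hT => by rw [h T (Finset.mem_powerset.1 hT)]

lemma expect_insert {A : Finset N} {a : N} (ha : a ∉ A) (F : Finset N → ℝ) :
    expect p (insert a A) F =
      (1 - p a) * expect p A F + p a * expect p A fun T => F (insert a T) := by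
  rw [expect, Finset.sum_powerset_insert ha, expect, expect, Finset.mul_sum, Finset.mul_sum]
  congr 1
  · refine Finset.sum_congr rfl fun T hT => ?_
    have haT : a ∉ T := fun h => ha (Finset.mem_powerset.1 hT h)
    rw [Finset.insert_sdiff_of_notMem _ haT,
      Finset.prod_insert fun h => ha (Finset.mem_sdiff.1 h).1]
    ring
  · refine Finset.sum_congr rfl fun T hT => ?_
    have haT : a ∉ T := fun h => ha (Finset.mem_powerset.1 hT h)
    rw [Finset.prod_insert haT, Finset.insert_sdiff_insert, Finset.sdiff_insert_of_notMem ha]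
    ring

lemma expect_add (A : Finset N) (F G : Finset N → ℝ) :
    (expect p A fun T => F T + G T) = expect p A F + expect p A G := by
  simp only [expect, mul_add, Finset.sum_add_distrib]

lemma expect_mul (A : Finset N) (x : ℝ) (F : Finset N → ℝ) :
    (expect p A fun T => x * F T) = x * expect p A F := by
  simp only [expect, Finset.mul_sum]
  exact Finset.sum_congr rfl fun T _ => by ring

lemma expect_const (A : Finset N) (x : ℝ) : (expect p A fun _ => x) = x := by
  induction A using Finset.induction_on with
  | empty => simp [expect]
  | insert a A ha ih =>
    rw [expect_insert p ha, ih]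
    ring

lemma expect_card (q : N → Prop) [DecidablePred q] (A : Finset N) :
    (expect p A fun T => ((T.filter q).card : ℝ)) = ∑ i ∈ A.filter q, p i := by
  induction A using Finset.induction_on with
  | empty => simp [expect]
  | insert a A ha ih =>
    rw [expect_insert p ha, ih, Finset.filter_insert]
    have h : (expect p A fun T => (((insert a T).filter q).card : ℝ)) =
        (if q a then 1 else 0) + ∑ i ∈ A.filter q, p i := by
      rw [← ih, ← expect_const p A (if q a then 1 else 0), ← expect_add]
      refine expect_congr fun T hT => ?_
      rw [Finset.filter_insert]
      split_ifs
      · rw [Finset.card_insert_of_notMem fun h => ha (hT (Finset.mem_filter.1 h).1)]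
        push_cast
        ring
      · ring
    rw [h]
    split_ifs
    · rw [Finset.sum_insert fun h => ha (Finset.mem_filter.1 h).1]
      ring
    · ring

lemma expect_union {A B : Finset N} (hAB : Disjoint A B) (F G : Finset N → ℝ) :
    (expect p (A ∪ B) fun T => F (T ∩ A) * G (T ∩ B)) = expect p A F * expect p B G := by
  induction B using Finset.induction_on generalizing G with
  | empty =>
    rw [Finset.union_empty, mul_comm, show expect p ∅ G = G ∅ by simp [expect], ← expect_mul]
    refine expect_congr fun T hT => ?_
    rw [Finset.inter_eq_left.2 hT, Finset.inter_empty, mul_comm]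
  | insert b B hb ih =>
    rw [Finset.disjoint_insert_right] at hAB
    have hbAB : b ∉ A ∪ B := by simp [hAB.1, hb]
    rw [Finset.union_insert, expect_insert p hbAB, expect_insert p hb]
    have h1 : (expect p (A ∪ B) fun T => F (T ∩ A) * G (T ∩ insert b B)) =
        expect p A F * expect p B G := by
      rw [← ih hAB.2]
      refine expect_congr fun T hT => ?_
      rw [Finset.inter_insert_of_notMem fun h => hbAB (hT h)]
    have h2 : (expect p (A ∪ B) fun T => F (insert b T ∩ A) * G (insert b T ∩ insert b B)) =
        expect p A F * expect p B fun T => G (insert b T) := by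
      rw [← ih hAB.2 fun T => G (insert b T)]
      refine expect_congr fun T hT => ?_
      rw [Finset.insert_inter_of_notMem hAB.1, ← Finset.insert_inter_distrib]
    rw [h1, h2]
    ring

lemma expect_prod {ι : Type*} [DecidableEq ι] (R : Finset N) (A : ι → Finset N) (J : Finset ι)
    (hR : ∀ g ∈ J, Disjoint R (A g)) (hA : ∀ g ∈ J, ∀ g' ∈ J, g ≠ g' → Disjoint (A g) (A g'))
    (F : Finset N → ℝ) (G : Finset N → ℝ) :
    (expect p (R ∪ J.biUnion A) fun T => F (T ∩ R) * ∏ g ∈ J, G (T ∩ A g)) =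
      expect p R F * ∏ g ∈ J, expect p (A g) G := by
  induction J using Finset.induction_on with
  | empty =>
    simp only [Finset.biUnion_empty, Finset.union_empty, Finset.prod_empty, mul_one]
    exact expect_congr fun T hT => by rw [Finset.inter_eq_left.2 hT]
  | insert a J ha ih =>
    have hdis : Disjoint (R ∪ J.biUnion A) (A a) := by
      rw [Finset.disjoint_union_left, Finset.disjoint_biUnion_left]
      exact ⟨hR a (Finset.mem_insert_self _ _), fun g hg => hA g (Finset.mem_insert_of_mem hg) a
        (Finset.mem_insert_self _ _) fun h => ha (h ▸ hg)⟩
    have h1 := expect_union p hdis (fun T => F (T ∩ R) * ∏ g ∈ J, G (T ∩ A g)) G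
    rw [ih (fun g hg => hR g (Finset.mem_insert_of_mem hg)) fun g hg g' hg' =>
      hA g (Finset.mem_insert_of_mem hg) g' (Finset.mem_insert_of_mem hg')] at h1
    rw [Finset.prod_insert ha, mul_comm (expect p (A a) G), ← mul_assoc, ← h1,
      Finset.biUnion_insert, Finset.union_comm (A a), ← Finset.union_assoc]
    refine expect_congr fun T _ => ?_
    rw [Finset.prod_insert ha, Finset.inter_assoc,
      Finset.inter_eq_right.2 (Finset.subset_union_left : R ⊆ R ∪ J.biUnion A),
      mul_comm (G (T ∩ A a)), ← mul_assoc]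
    congr 2
    refine Finset.prod_congr rfl fun g hg => ?_
    rw [Finset.inter_assoc, Finset.inter_eq_right.2
      ((Finset.subset_biUnion_of_mem A hg).trans Finset.subset_union_right)]

variable {p} (hp : ∀ i, 0 ≤ p i ∧ p i ≤ 1)
include hp

lemma one_sub_sum_le_prod (A : Finset N) : 1 - ∑ i ∈ A, p i ≤ ∏ i ∈ A, (1 - p i) := by
  induction A using Finset.induction_on with
  | empty => simp
  | insert a A ha ih =>
    rw [Finset.sum_insert ha, Finset.prod_insert ha]
    have h1 := hp a
    have h2 : 0 ≤ ∑ i ∈ A, p i := Finset.sum_nonneg fun i _ => (hp i).1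
    nlinarith

/-- Exactly one arrival has probability at least `1/4 * 1/2`: when agent `i` comes, the others are
all absent with probability at least one minus their expected number. -/
lemma expect_card_ne_one_le {A : Finset N} (h1 : 1 / 4 ≤ ∑ i ∈ A, p i)
    (h2 : A.card = 1 ∨ ∑ i ∈ A, p i ≤ 1 / 2) :
    (expect p A fun T => if T.card = 1 then 0 else 1) ≤ 7 / 8 := by
  have hsum : (expect p A fun T => if T.card = 1 then 0 else 1) +
      (expect p A fun T => if T.card = 1 then 1 else 0) = 1 := by
    rw [← expect_add, ← expect_const p A 1]
    refine expect_congr fun T _ => ?_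
    rw [expect_const]
    split_ifs <;> norm_num
  have hone : (expect p A fun T => if T.card = 1 then 1 else 0) =
      ∑ i ∈ A, p i * ∏ k ∈ A \ {i}, (1 - p k) := by
    simp only [expect, mul_ite, mul_one, mul_zero]
    rw [← Finset.sum_filter, ← Finset.powersetCard_eq_filter, Finset.powersetCard_one,
      Finset.sum_map]
    simp
  suffices h : 1 / 8 ≤ ∑ i ∈ A, p i * ∏ k ∈ A \ {i}, (1 - p k) by linarith
  rcases h2 with h2 | h2
  · obtain ⟨a, rfl⟩ := Finset.card_eq_one.1 h2
    simp only [Finset.sum_singleton, Finset.sdiff_self, Finset.prod_empty, mul_one] at h1 ⊢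
    linarith
  · calc (1 / 8 : ℝ) ≤ ∑ i ∈ A, p i * (1 / 2) := by rw [← Finset.sum_mul]; linarith
      _ ≤ _ := Finset.sum_le_sum fun i _ => by
        refine mul_le_mul_of_nonneg_left ?_ (hp i).1
        refine le_trans ?_ (one_sub_sum_le_prod hp _)
        have := Finset.sum_le_sum_of_subset_of_nonneg (f := p) (Finset.sdiff_subset (s := A) (t := {i}))
          fun k _ _ => (hp k).1
        linarith

/-- An agent of probability at least 1/4 is a group by herself; otherwise a minimal set of weight at
least 1/4 overshoots by less than 1/4. -/
lemma exists_group {U : Finset N} (hU : 1 ≤ ∑ i ∈ U, p i) :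
    ∃ A ⊆ U, 1 / 4 ≤ ∑ i ∈ A, p i ∧ ∑ i ∈ A, p i ≤ 1 ∧ (A.card = 1 ∨ ∑ i ∈ A, p i ≤ 1 / 2) := by
  by_cases hbig : ∃ i ∈ U, 1 / 4 ≤ p i
  · obtain ⟨i, hi, h⟩ := hbig
    exact ⟨{i}, by simpa, by simpa using h, by simpa using (hp i).2, Or.inl (by simp)⟩
  push Not at hbig
  obtain ⟨A, hA, hmin⟩ := Finset.exists_min_image (U.powerset.filter fun A => 1 / 4 ≤ ∑ i ∈ A, p i)
    Finset.card ⟨U, by simpa using le_trans (by norm_num) hU⟩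
  simp only [Finset.mem_filter, Finset.mem_powerset] at hA hmin
  have hne : A.Nonempty := by
    by_contra h
    rw [Finset.not_nonempty_iff_eq_empty] at h
    rw [h, Finset.sum_empty] at hA
    linarith [hA.2]
  obtain ⟨a, ha⟩ := hne
  have hlt : ∑ i ∈ A.erase a, p i < 1 / 4 := by
    by_contra! h
    have := hmin (A.erase a) ⟨(Finset.erase_subset _ _).trans hA.1, h⟩
    have := Finset.card_erase_lt_of_mem ha
    omega
  have h2 := hbig a (hA.1 ha)
  have h3 := Finset.add_sum_erase A p ha
  exact ⟨A, hA.1, hA.2, by linarith, Or.inr (by linarith)⟩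

/-- Each group uses up at most 1 of the total weight, so `L` groups can be chosen successively. -/
lemma exists_groups (L : ℕ) (U : Finset N) (hU : (L : ℝ) ≤ ∑ i ∈ U, p i) :
    ∃ grp : N → ℕ, (∀ i, grp i ≤ L) ∧ (∀ i, grp i ≠ 0 → i ∈ U) ∧ ∀ g ∈ Finset.Icc 1 L,
      1 / 4 ≤ ∑ i ∈ U.filter fun i => grp i = g, p i ∧
      ∑ i ∈ U.filter fun i => grp i = g, p i ≤ 1 ∧
      ((U.filter fun i => grp i = g).card = 1 ∨
        ∑ i ∈ U.filter fun i => grp i = g, p i ≤ 1 / 2) := by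
  induction L generalizing U with
  | zero => exact ⟨fun _ => 0, by simp, by simp, by simp⟩
  | succ L ih =>
    push_cast at hU
    obtain ⟨A, hAU, h1, h2, h3⟩ := exists_group hp
      (show 1 ≤ ∑ i ∈ U, p i by linarith [(Nat.cast_nonneg L : (0 : ℝ) ≤ L)])
    have hsd := Finset.sum_sdiff (f := p) hAU
    obtain ⟨grp, hg1, hg2, hg3⟩ := ih (U \ A) (by linarith)
    refine ⟨fun i => if i ∈ A then L + 1 else grp i, fun i => ?_, fun i hi => ?_, fun g hg => ?_⟩
    · have := hg1 i
      dsimp only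
      split_ifs <;> omega
    · by_cases hiA : i ∈ A
      · exact hAU hiA
      · simp only [if_neg hiA] at hi
        exact (Finset.mem_sdiff.1 (hg2 i hi)).1
    · obtain ⟨hg0, hgL⟩ := Finset.mem_Icc.1 hg
      rcases hgL.eq_or_lt with rfl | hlt
      · have : (U.filter fun i => (if i ∈ A then L + 1 else grp i) = L + 1) = A := by
          ext i
          have := hg1 i
          simp only [Finset.mem_filter]
          constructor
          · rintro ⟨_, h⟩
            by_contra hiA
            rw [if_neg hiA] at h
            omega
          · exact fun h => ⟨hAU h, if_pos h⟩
        rw [this]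
        exact ⟨h1, h2, h3⟩
      · have : (U.filter fun i => (if i ∈ A then L + 1 else grp i) = g) =
            (U \ A).filter fun i => grp i = g := by
          ext i
          simp only [Finset.mem_filter, Finset.mem_sdiff]
          by_cases hiA : i ∈ A
          · simp only [hiA, if_true]
            refine iff_of_false (fun h => ?_) (by simp)
            omega
          · simp [hiA]
        rw [this]
        exact hg3 g (Finset.mem_Icc.2 ⟨hg0, by omega⟩)

end Expectation

/-! ### The protocol and its expected price of anarchy -/

section Main

variable {N : Type*} [Fintype N] [DecidableEq N] {p : N → ℝ}

lemma sum_arrivalProb_mul (F : Finset N → ℝ) :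
    ∑ S : Finset N, arrivalProb p S * F S = expect p Finset.univ F := by
  simp only [expect, arrivalProb, Finset.powerset_univ, Finset.compl_eq_univ_sdiff]

lemma expectedArrivals_eq : expectedArrivals p = ∑ i, p i := by
  rw [expectedArrivals, sum_arrivalProb_mul]
  simpa using expect_card p (fun _ => True) Finset.univ

lemma arrivalProb_nonneg (hp : ∀ i, 0 ≤ p i ∧ p i ≤ 1) (S : Finset N) : 0 ≤ arrivalProb p S :=
  mul_nonneg (Finset.prod_nonneg fun i _ => (hp i).1)
    (Finset.prod_nonneg fun i _ => sub_nonneg.2 (hp i).2)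

/-- The indicator of the event that none of the groups `1, …, L` has exactly one agent in `S`. -/
noncomputable def noLone (grp : N → ℕ) (L : ℕ) (S : Finset N) : ℝ :=
  ∏ g ∈ Finset.Icc 1 L,
    if (S ∩ Finset.univ.filter fun i => grp i = g).card = 1 then 0 else 1

lemma noLone_nonneg (grp : N → ℕ) (L : ℕ) (S : Finset N) : 0 ≤ noLone grp L S :=
  Finset.prod_nonneg fun g _ => by split_ifs <;> norm_num

/-- Regular agents and the groups are disjoint, so the expectation factorises. -/
lemma expect_regulars_mul_noLone_le (hp : ∀ i, 0 ≤ p i ∧ p i ≤ 1) {grp : N → ℕ} {L : ℕ}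
    (hgrp : ∀ i, grp i ≤ L) (hg : ∀ g ∈ Finset.Icc 1 L,
      1 / 4 ≤ ∑ i ∈ Finset.univ.filter fun i => grp i = g, p i ∧
      ((Finset.univ.filter fun i => grp i = g).card = 1 ∨
        ∑ i ∈ Finset.univ.filter fun i => grp i = g, p i ≤ 1 / 2)) :
    (expect p Finset.univ fun S => ((regulars grp S).card : ℝ) * noLone grp L S) ≤
      (∑ i, p i) * (7 / 8) ^ L := by
  have hdis : ∀ g g' : ℕ, g ≠ g' → Disjoint (Finset.univ.filter fun i => grp i = g)
      (Finset.univ.filter fun i => grp i = g') := fun g g' hgg' =>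
    Finset.disjoint_filter.2 fun i _ h h' => hgg' (h.symm.trans h')
  have huniv : (Finset.univ.filter fun i => grp i = 0) ∪
      (Finset.Icc 1 L).biUnion (fun g => Finset.univ.filter fun i => grp i = g) = Finset.univ := by
    ext i
    have := hgrp i
    simp only [Finset.mem_union, Finset.mem_filter, Finset.mem_univ, true_and, Finset.mem_biUnion,
      Finset.mem_Icc, exists_eq_right', iff_true]
    omega
  have h := expect_prod p (Finset.univ.filter fun i => grp i = 0)
    (fun g => Finset.univ.filter fun i => grp i = g) (Finset.Icc 1 L)
    (fun g hg' => hdis 0 g (by have := Finset.mem_Icc.1 hg'; omega)) (fun g _ g' _ => hdis g g')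
    (fun T => (T.card : ℝ)) (fun T => if T.card = 1 then 0 else 1)
  rw [huniv] at h
  have h0 : (expect p Finset.univ fun S => ((regulars grp S).card : ℝ) * noLone grp L S) =
      (expect p (Finset.univ.filter fun i => grp i = 0) fun T => (T.card : ℝ)) *
        ∏ g ∈ Finset.Icc 1 L, expect p (Finset.univ.filter fun i => grp i = g)
          fun T => if T.card = 1 then 0 else 1 := by
    rw [← h]
    refine expect_congr fun T _ => ?_
    rw [noLone]
    congr 3
    ext i
    simp
  have hsub : ∑ i ∈ Finset.univ.filter (fun i => grp i = 0), p i ≤ ∑ i, p i :=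
    Finset.sum_le_sum_of_subset_of_nonneg (Finset.subset_univ _) fun i _ _ => (hp i).1
  have hnonneg : ∀ g, 0 ≤ expect p (Finset.univ.filter fun i => grp i = g)
      fun T => if T.card = 1 then 0 else 1 := fun g =>
    Finset.sum_nonneg fun T _ => mul_nonneg (mul_nonneg (Finset.prod_nonneg fun i _ => (hp i).1)
      (Finset.prod_nonneg fun i _ => sub_nonneg.2 (hp i).2))
      (by dsimp only; split_ifs <;> norm_num)
  have h1 := expect_card p (fun _ => True) (Finset.univ.filter fun i => grp i = 0)
  simp only [Finset.filter_true] at h1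
  rw [h0, h1]
  refine mul_le_mul hsub ?_ (Finset.prod_nonneg fun g _ => hnonneg g)
    (Finset.sum_nonneg fun i _ => (hp i).1)
  calc _ ≤ ∏ g ∈ Finset.Icc 1 L, (7 / 8 : ℝ) := Finset.prod_le_prod (fun g _ => hnonneg g)
        fun g hg' => expect_card_ne_one_le hp (hg g hg').1 (hg g hg').2
    _ = _ := by rw [Finset.prod_const, Nat.card_Icc, Nat.add_sub_cancel]

omit [DecidableEq N] in
lemma sum_leaders_le {grp : N → ℕ} {L : ℕ} (hgrp : ∀ i, grp i ≤ L)
    (hg : ∀ g ∈ Finset.Icc 1 L, ∑ i ∈ Finset.univ.filter fun i => grp i = g, p i ≤ 1) :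
    ∑ i ∈ Finset.univ.filter fun i => grp i ≠ 0, p i ≤ L := by
  rw [← Finset.sum_fiberwise_of_maps_to (t := Finset.Icc 1 L) (g := grp)]
  · calc _ ≤ ∑ g ∈ Finset.Icc 1 L, (1 : ℝ) := by
          refine Finset.sum_le_sum fun g hg' => le_trans (le_of_eq ?_) (hg g hg')
          congr 1
          ext i
          have := Finset.mem_Icc.1 hg'
          simp only [Finset.mem_filter, Finset.mem_univ, true_and]
          omega
      _ = _ := by simp
  · intro i hi
    have := hgrp i
    have := (Finset.mem_filter.1 hi).2
    exact Finset.mem_Icc.2 ⟨by omega, by omega⟩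

/-- With a lone leader the refined bound applies; otherwise `noLone` is 1 and the bound by `|S|`
splits into leaders and regular agents. -/
theorem poa_share_le_noLone {m n₀ : ℕ} {c : Fin m → ℕ → ℝ≥0∞} (pl : Plan m c n₀) {b L : ℕ}
    {grp e : N → ℕ} (he : Function.Injective e) (hc : ∀ j, Monotone (c j)) {S : Finset N}
    (hn₀ : S.card ≤ n₀) :
    poa c (pl.share b grp e) S ≤ ENNReal.ofReal
      (8 * (4 * (leaders grp S).card + 2 * b + 3 + (regulars grp S).card * noLone grp L S)) := by
  have hRL := card_regulars_add_card_leaders grp S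
  by_cases hlone : ∃ g ∈ Finset.Icc 1 L, (S ∩ Finset.univ.filter fun i => grp i = g).card = 1
  · obtain ⟨g, hg, h1⟩ := hlone
    obtain ⟨a, ha⟩ := Finset.card_eq_one.1 h1
    have hmem : ∀ i, i ∈ S ∧ grp i = g ↔ i = a := fun i => by
      rw [← Finset.mem_singleton (a := a), ← ha]
      simp
    obtain ⟨haS, hag⟩ := (hmem a).2 rfl
    refine (pl.poa_share_le_of_lone hn₀ hc he haS
      (by have := Finset.mem_Icc.1 hg; omega) fun i hi h => (hmem i).1 ⟨hi, h.trans hag⟩).trans ?_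
    rw [← ENNReal.ofReal_natCast]
    apply ENNReal.ofReal_le_ofReal
    have := mul_nonneg (Nat.cast_nonneg (regulars grp S).card : (0 : ℝ) ≤ _)
      (noLone_nonneg grp L S)
    have : (0 : ℝ) ≤ (leaders grp S).card := Nat.cast_nonneg _
    push_cast
    linarith
  · push Not at hlone
    refine (pl.poa_share_le hn₀).trans ?_
    rw [← ENNReal.ofReal_natCast]
    apply ENNReal.ofReal_le_ofReal
    rw [noLone, Finset.prod_eq_one fun g hg => if_neg (hlone g hg), ← hRL]
    have : (0 : ℝ) ≤ (leaders grp S).card := Nat.cast_nonneg _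
    push_cast
    linarith [(Nat.cast_nonneg b : (0 : ℝ) ≤ b)]

open Classical in
/-- The protocol that charges the shares of a plan. -/
noncomputable def planProtocol (b : ℕ) (grp e : N → ℕ) : Protocol N := fun _ c =>
  if h : ∀ j, IsFourStepCost (c j) then (exists_plan h (Fintype.card N)).some.share b grp e
  else fun _ _ _ => 0

omit [DecidableEq N] in
lemma planProtocol_isCostSharing (b : ℕ) (grp e : N → ℕ) :
    (planProtocol b grp e).IsCostSharing := by
  intro m c hc j T
  rw [planProtocol, dif_pos hc]
  exact ⟨Plan.cost_le_sum_share _ b grp e (fun j => (hc j).mono) (fun j => (hc j).zero) j T,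
    fun h i _ => Plan.share_ne_top _ b grp e (Finset.card_le_univ T) h i⟩

lemma planProtocol_isStable {b L : ℕ} {grp : N → ℕ} (e : N → ℕ) (hgrp : ∀ i, grp i ≤ L)
    (hb : 3 * L ≤ b) : (planProtocol b grp e).IsStable := by
  intro m c hm hc S
  rw [planProtocol, dif_pos hc]
  exact Plan.exists_isPNE _ b grp e hm hgrp hb S

lemma planProtocol_expectedPoA_le (hp : ∀ i, 0 ≤ p i ∧ p i ≤ 1) {L : ℕ} {grp e : N → ℕ}
    (he : Function.Injective e) (hgrp : ∀ i, grp i ≤ L) (hg : ∀ g ∈ Finset.Icc 1 L,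
      1 / 4 ≤ ∑ i ∈ Finset.univ.filter fun i => grp i = g, p i ∧
      ∑ i ∈ Finset.univ.filter fun i => grp i = g, p i ≤ 1 ∧
      ((Finset.univ.filter fun i => grp i = g).card = 1 ∨
        ∑ i ∈ Finset.univ.filter fun i => grp i = g, p i ≤ 1 / 2)) :
    (planProtocol (3 * L) grp e).expectedPoA p ≤
      ENNReal.ofReal (8 * (10 * L + 3 + (∑ i, p i) * (7 / 8) ^ L)) := by
  refine iSup_le fun m => iSup_le fun c => iSup_le fun _ => iSup_le fun hc => ?_
  calc _ ≤ ∑ S : Finset N, ENNReal.ofReal (arrivalProb p S * (8 * (4 * (leaders grp S).card +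
          2 * (3 * L : ℕ) + 3 + (regulars grp S).card * noLone grp L S))) := by
        refine Finset.sum_le_sum fun S _ => ?_
        rw [planProtocol, dif_pos hc, ENNReal.ofReal_mul (arrivalProb_nonneg hp S)]
        gcongr
        exact poa_share_le_noLone _ he (fun j => (hc j).mono) (Finset.card_le_univ S)
    _ = ENNReal.ofReal (expect p Finset.univ fun S => 8 * (4 * (leaders grp S).card +
          2 * (3 * L : ℕ) + 3 + (regulars grp S).card * noLone grp L S)) := by
        rw [← sum_arrivalProb_mul, ENNReal.ofReal_sum_of_nonneg]
        intro S _
        have := mul_nonneg (Nat.cast_nonneg (regulars grp S).card : (0 : ℝ) ≤ _)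
          (noLone_nonneg grp L S)
        exact mul_nonneg (arrivalProb_nonneg hp S) (by positivity)
    _ ≤ _ := by
        apply ENNReal.ofReal_le_ofReal
        rw [expect_mul, expect_add, expect_add, expect_add, expect_mul, expect_const, expect_const]
        have h1 := expect_regulars_mul_noLone_le hp hgrp fun g hg' => ⟨(hg g hg').1, (hg g hg').2.2⟩
        have h2 := expect_card p (fun i => grp i ≠ 0) Finset.univ
        have h3 := sum_leaders_le hgrp fun g hg' => (hg g hg').2.1
        rw [← h2] at h3
        unfold leaders
        push_cast
        linarith

/-- With `⌈8 log x⌉` groups it is unlikely that no group has exactly one arriving agent. -/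
lemma exists_group_count {x : ℝ} (hx : 0 ≤ x) : ∃ L : ℕ, (L : ℝ) ≤ x ∧
    8 * (10 * L + 3 + x * (7 / 8) ^ L) ≤ 752 * max 1 (Real.log x) := by
  have hmax := le_max_left 1 (Real.log x)
  have hmax' := le_max_right 1 (Real.log x)
  rcases lt_or_ge x 64 with hlt | hge
  · refine ⟨0, by simpa, ?_⟩
    simp only [Nat.cast_zero, pow_zero]
    linarith
  · have hpos : 0 < x := by linarith
    have hlog0 : 0 ≤ Real.log x := Real.log_nonneg (by linarith)
    have hceil := Nat.ceil_lt_add_one (a := 8 * Real.log x) (by positivity)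
    have hle := Nat.le_ceil (8 * Real.log x)
    refine ⟨⌈8 * Real.log x⌉₊, ?_, ?_⟩
    -- The tangent of the logarithm at 64 gives `8 * log x + 1 ≤ x`, so the total weight suffices
    -- for this many groups.
    · have h64 : Real.log 64 = 6 * Real.log 2 := by
        rw [show (64 : ℝ) = 2 ^ 6 by norm_num, Real.log_pow]
        norm_num
      have hdiv : Real.log x = Real.log 64 + Real.log (x / 64) := by
        rw [← Real.log_mul (by norm_num) (by positivity)]
        congr 1
        field_simp
      have h1 := Real.log_le_sub_one_of_pos (show 0 < x / 64 by positivity)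
      have h2 := Real.log_two_lt_d9
      linarith
    · have h1 : (7 / 8 : ℝ) ^ ⌈8 * Real.log x⌉₊ ≤ x⁻¹ := by
        calc (7 / 8 : ℝ) ^ ⌈8 * Real.log x⌉₊ ≤ Real.exp (-(1 / 8)) ^ ⌈8 * Real.log x⌉₊ := by
              gcongr
              have := Real.one_sub_le_exp_neg (1 / 8)
              linarith
          _ = Real.exp (⌈8 * Real.log x⌉₊ * -(1 / 8)) := (Real.exp_nat_mul _ _).symm
          _ ≤ Real.exp (-Real.log x) := by
              apply Real.exp_le_exp.2
              linarith
          _ = x⁻¹ := by rw [Real.exp_neg, Real.exp_log hpos]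
      have h2 : x * (7 / 8 : ℝ) ^ ⌈8 * Real.log x⌉₊ ≤ 1 := by
        calc _ ≤ x * x⁻¹ := by gcongr
          _ = 1 := mul_inv_cancel₀ hpos.ne'
      linarith

end Main

theorem mainTheorem8 :
    ∃ C : ℝ, 0 < C ∧
      ∀ (N : Type*) [Fintype N] [DecidableEq N] (p : N → ℝ),
        (∀ i, 0 ≤ p i ∧ p i ≤ 1) →
        ∃ Ξ : Protocol N, Ξ.IsCostSharing ∧ Ξ.IsStable ∧
          Ξ.expectedPoA p ≤ ENNReal.ofReal (C * max 1 (Real.log (expectedArrivals p))) := by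
  -- `752 = 8 * (10 * (8 + 1) + 3 + 1)`, from `L ≤ 8 * log ñ + 1` and a final term of at most 1.
  refine ⟨752, by norm_num, fun N _ _ p hp => ?_⟩
  obtain ⟨e, he⟩ := Countable.exists_injective_nat N
  obtain ⟨L, hL, hbound⟩ := exists_group_count (Finset.sum_nonneg fun i (_ : i ∈ Finset.univ) => (hp i).1)
  obtain ⟨grp, hgrp, -, hg⟩ := exists_groups hp L Finset.univ hL
  refine ⟨planProtocol (3 * L) grp e, planProtocol_isCostSharing _ _ _,
    planProtocol_isStable e hgrp le_rfl, (planProtocol_expectedPoA_le hp he hgrp hg).trans ?_⟩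
  rw [expectedArrivals_eq]
  exact ENNReal.ofReal_le_ofReal hbound
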